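/- Monoids are commutative with $1$ and an absorbing element $0$. For a monoid $A$, an $A$-module is a pointed set $(M,*)$ with an action of $A$ such that $0\cdot m=*$ and $a\cdot *=*$. A pointed map $f:M\to N$ is called normal if it is injective on $M\setminus f^{-1}(*)$; an $A$-module $M$ is normal if $m\mapsto a\cdot m$ is normal for every $a\in A$. Let $\mathbb{P}^1$ be the monoid scheme (a space with a sheaf of monoids that is locally the prime spectrum of a monoid) obtained by gluing $\operatorname{Spec}\langle t\rangle$ and $\operatorname{Spec}\langle t^{-1}\rangle$ along $\operatorname{Spec}\langle t,t^{-1}\rangle$, where $\langle t\rangle=\{0,1,t,t^2,\dots\}$, $\langle t^{-1}\rangle=\{0,1,t^{-1},t^{-2},\dots\}$ and $\langle t,t^{-1}\rangle=\{0\}\cup\{t^n:n\in\mathbb{Z}\}$. A sheaf $\mathcal{F}$ of $\mathcal{O}_{\mathbb{P}^1}$-modules (in pointed sets) is coherent if every point has an affine open neighbourhood $U$ with $\mathcal{F}|_U\cong\widetilde{M}$ for a finitely generated $\mathcal{O}(U)$-module $M$, where $\widetilde{M}$ is the sheaf of localizations of $M$; it is normal if moreover, for every affine open $U$, $\mathcal{F}|_U\cong\widetilde{M}$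 for a normal $\mathcal{O}(U)$-module $M$. A morphism of sheaves of modules is normal if the map it induces on sections over each affine open subset is normal. Let $Coh_n(\mathbb{P}^1)$ be the category of normal coherent sheaves on $\mathbb{P}^1$ and normal morphisms. Let $\mathcal{F},\mathcal{G}$ be normal coherent sheaves on $\mathbb{P}^1$. Then: 1. The set $\operatorname{Hom}(\mathcal{F},\mathcal{G})$ of morphisms in $Coh_n(\mathbb{P}^1)$ is finite. 2. The number of extensions of $\mathcal{F}$ by $\mathcal{G}$ is finite. That is, there are only finitely many short exact sequences $\emptyset\to\mathcal{G}\to\mathcal{E}\to\mathcal{F}\to\emptyset$ in $Coh_n(\mathbb{P}^1)$ (where $\emptyset$ is the zero sheaf), up to isomorphisms of the middle terms $\mathcal{E}$ that induce the identity on $\mathcal{F}$ and on $\mathcal{G}$. -/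

import Mathlib

open TopologicalSpace CategoryTheory

universe w u

namespace FOne

/-! Monoids are commutative with `1` and `0`: this is `CommMonoidWithZero A`. An `A`-module is a
pointed set with an action of `A`: this is `MulActionWithZero A M` (the base point is `0`). -/

/-! ### Spectrum of a monoid -/

/-- The prime ideals of a monoid with zero (proper, and nonempty, i.e. containing `0`). -/
@[ext]
structure Spec (A : Type w) [CommMonoidWithZero A] where
  ideal : SemigroupIdeal A
  zero_mem : (0 : A) ∈ ideal
  one_notMem : (1 : A) ∉ ideal
  mem_or_mem : ∀ x y : A, x * y ∈ ideal → x ∈ ideal ∨ y ∈ ideal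

namespace Spec

variable {A : Type w} [CommMonoidWithZero A]

/-- The multiplicative set `A \ p`. -/
def primeCompl (p : Spec A) : Submonoid A where
  carrier := {a | a ∉ p.ideal}
  one_mem' := p.one_notMem
  mul_mem' := fun {a b} ha hb hab => (p.mem_or_mem a b hab).elim ha hb

/-- The closed set `V(S)`, the primes containing `S` (equivalently the ideal generated by `S`). -/
def zeroLocus (S : Set A) : Set (Spec A) := {p | ∀ a ∈ S, a ∈ p.ideal}

/-- The topology whose closed sets are the `V(S)`. -/
instance : TopologicalSpace (Spec A) :=
  TopologicalSpace.ofClosed {Z | ∃ S : Set A, Z = zeroLocus S}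
    ⟨{1}, by
      ext p
      simp only [zeroLocus, Set.mem_empty_iff_false, Set.mem_singleton_iff, forall_eq,
        Set.mem_ofPred_eq, false_iff]
      exact p.one_notMem⟩
    (by
      intro C hC
      refine ⟨{a | ∃ S : Set A, zeroLocus S ∈ C ∧ a ∈ S}, ?_⟩
      ext p
      constructor
      · rintro hp a ⟨S, hS, ha⟩
        exact hp _ hS a ha
      · intro hp Z hZ
        obtain ⟨S, rfl⟩ := hC hZ
        exact fun a ha => hp a ⟨S, hZ, ha⟩)
    (by
      rintro _ ⟨S, rfl⟩ _ ⟨T, rfl⟩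
      refine ⟨{c | ∃ a ∈ S, ∃ b ∈ T, c = a * b}, ?_⟩
      ext p
      constructor
      · rintro (hp | hp) c ⟨a, ha, b, hb, rfl⟩
        · rw [mul_comm]
          exact p.ideal.mul_mem b (hp a ha)
        · exact p.ideal.mul_mem a (hp b hb)
      · intro hp
        by_contra hcon
        simp only [Set.mem_union, zeroLocus, Set.mem_ofPred_eq, not_or, not_forall] at hcon
        obtain ⟨⟨a, ha, hap⟩, ⟨b, hb, hbp⟩⟩ := hcon
        exact (p.mem_or_mem a b (hp _ ⟨a, ha, b, hb, rfl⟩)).elim hap hbp)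

theorem isOpen_iff {V : Set (Spec A)} : IsOpen V ↔ ∃ S : Set A, Vᶜ = zeroLocus S :=
  Iff.rfl

end Spec

/-! ### The sheaf on `Spec A` attached to a module -/

section Tilde

variable (A : Type w) [CommMonoidWithZero A] (M : Type u) [Zero M] [MulActionWithZero A M]

open OreLocalization in
/-- Sections over `U` of the sheaf `M~`: families of elements of the localizations
`M_p = (A \ p)⁻¹ M`, `p ∈ U`, that are locally given by one fraction `m / f`. -/
def Tilde (U : Opens (Spec A)) : Type (max u w) :=
  {s : ∀ p : U, OreLocalization p.1.primeCompl M //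
    ∀ p : U, ∃ (V : Opens (Spec A)) (hVU : V ≤ U) (m : M) (f : A), p.1 ∈ V ∧
      ∀ (q : Spec A) (hq : q ∈ V), ∃ hf : f ∉ q.ideal,
        s ⟨q, hVU hq⟩ = m /ₒ (⟨f, hf⟩ : q.primeCompl)}

/-- The structure sheaf of `Spec A`. -/
abbrev SpecO (U : Opens (Spec A)) : Type w := Tilde A A U

variable {A M}

/-- Restriction of sections of `M~`. -/
def Tilde.res {U V : Opens (Spec A)} (h : U ≤ V) (s : Tilde A M V) : Tilde A M U :=
  ⟨fun p => s.1 ⟨p.1, h p.2⟩, fun p => by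
    obtain ⟨W, hW, m, f, hp, hs⟩ := s.2 ⟨p.1, h p.2⟩
    refine ⟨W ⊓ U, inf_le_right, m, f, ⟨hp, p.2⟩, fun q hq => ?_⟩
    exact hs q hq.1⟩

/-- The action of the structure sheaf on `M~`, pointwise. -/
instance (U : Opens (Spec A)) : SMul (SpecO A U) (Tilde A M U) where
  smul a s := ⟨fun p => a.1 p • s.1 p, fun p => by
    obtain ⟨V, hV, r, f, hpV, ha⟩ := a.2 p
    obtain ⟨W, hW, m, g, hpW, hs⟩ := s.2 p
    refine ⟨V ⊓ W, inf_le_left.trans hV, r • m, g * f, ⟨hpV, hpW⟩, fun q hq => ?_⟩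
    obtain ⟨hf, hf'⟩ := ha q hq.1
    obtain ⟨hg, hg'⟩ := hs q hq.2
    refine ⟨q.primeCompl.mul_mem hg hf, ?_⟩
    change a.1 _ • s.1 _ = _
    rw [hf', hg', OreLocalization.oreDiv_smul_char r m ⟨f, hf⟩ ⟨g, hg⟩ r ⟨g, hg⟩ (mul_comm _ _)]
    rfl⟩

/-- The multiplication of the structure sheaf, pointwise. -/
instance (U : Opens (Spec A)) : Mul (SpecO A U) where
  mul a b := ⟨fun p => a.1 p * b.1 p, (a • b).2⟩

end Tilde

/-! ### Monoidal spaces and monoid schemes -/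

/-- A topological space with a sheaf of commutative monoids with zero. -/
structure MonoidalSpace where
  carrier : Type w
  [top : TopologicalSpace carrier]
  O : Opens carrier → Type w
  [mon : ∀ U, CommMonoidWithZero (O U)]
  res : ∀ {U V : Opens carrier}, U ≤ V → O V →*₀ O U
  res_self : ∀ (U : Opens carrier) (s : O U), res le_rfl s = s
  res_res : ∀ {U V W : Opens carrier} (h : U ≤ V) (h' : V ≤ W) (s : O W),
    res h (res h' s) = res (h.trans h') s
  glue : ∀ (ι : Type w) (U : ι → Opens carrier) (s : ∀ i, O (U i)),
    (∀ i j, res (inf_le_left : U i ⊓ U j ≤ U i) (s i) =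
      res (inf_le_right : U i ⊓ U j ≤ U j) (s j)) →
    ∃! t : O (⨆ i, U i), ∀ i, res (le_iSup U i) t = s i

attribute [instance] MonoidalSpace.top MonoidalSpace.mon

/-- The image of an open set under an open embedding. -/
def imgOpen {X : Type*} {Y : Type*} [TopologicalSpace X] [TopologicalSpace Y] {f : X → Y}
    (hf : Topology.IsOpenEmbedding f) (V : Opens X) : Opens Y :=
  ⟨f '' V, hf.isOpenMap _ V.2⟩

theorem imgOpen_mono {X : Type*} {Y : Type*} [TopologicalSpace X] [TopologicalSpace Y] {f : X → Y}
    (hf : Topology.IsOpenEmbedding f) {V W : Opens X} (h : V ≤ W) : imgOpen hf V ≤ imgOpen hf W :=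
  Set.image_mono h

/-- An affine open subset `U` of `X`, with an isomorphism of monoidal spaces `Spec A ≅ U`: an open
embedding `Spec A → X` with image `U` and an isomorphism between the structure sheaves.
(A multiplicative bijection between monoids with zero preserves `1` and `0`, and an
isomorphism induces local maps on the stalks.) -/
structure AffineChart (X : MonoidalSpace.{w}) (A : Type w) [CommMonoidWithZero A] where
  toFun : Spec A → X.carrier
  isOpenEmbedding : Topology.IsOpenEmbedding toFun
  iso : ∀ V : Opens (Spec A), X.O (imgOpen isOpenEmbedding V) ≃* SpecO A V
  iso_res : ∀ {V W : Opens (Spec A)} (h : V ≤ W) (s : X.O (imgOpen isOpenEmbedding W)),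
    iso V (X.res (imgOpen_mono isOpenEmbedding h) s) = Tilde.res h (iso W s)

/-- The open set of `X` that corresponds to the open set `V` of `Spec A`. -/
abbrev AffineChart.img {X : MonoidalSpace.{w}} {A : Type w} [CommMonoidWithZero A]
    (c : AffineChart X A) (V : Opens (Spec A)) : Opens X.carrier :=
  imgOpen c.isOpenEmbedding V

/-- A monoid scheme: a monoidal space in which every point has an affine open neighbourhood. -/
structure MonoidScheme extends MonoidalSpace.{w} where
  locallyAffine : ∀ x : carrier, ∃ (A : Type w) (_ : CommMonoidWithZero A)
    (c : AffineChart toMonoidalSpace A), x ∈ Set.range c.toFun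

/-! ### Modules, normality -/

/-- A map of pointed sets that is injective away from the preimage of the base point. For a map
preserving the base point, this says that it is a morphism of vector spaces over the field with
one element. -/
def IsNormalMap {M N : Type*} [Zero N] (f : M → N) : Prop :=
  Set.InjOn f {m | f m ≠ 0}

/-- A normal `A`-module: every `a : A` acts by a normal map. -/
def IsNormalModule (A : Type*) (M : Type*) [CommMonoidWithZero A] [Zero M]
    [MulActionWithZero A M] : Prop :=
  ∀ a : A, IsNormalMap (fun m : M => a • m)

/-- A finitely generated `A`-module. -/
def IsFG (A : Type*) (M : Type*) [CommMonoidWithZero A] [Zero M]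
    [MulActionWithZero A M] : Prop :=
  ∃ S : Set M, S.Finite ∧ ∀ m : M, ∃ a : A, ∃ s ∈ S, m = a • s

/-! ### Sheaves of modules -/

/-- A sheaf of `O_X`-modules (a sheaf of pointed sets with an action of `O_X`). -/
structure ModuleSheaf (X : MonoidScheme.{w}) where
  sec : Opens X.carrier → Type u
  [zero : ∀ U, Zero (sec U)]
  [act : ∀ U, MulActionWithZero (X.O U) (sec U)]
  res : ∀ {U V : Opens X.carrier}, U ≤ V → sec V → sec U
  res_self : ∀ (U : Opens X.carrier) (s : sec U), res le_rfl s = s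
  res_res : ∀ {U V W : Opens X.carrier} (h : U ≤ V) (h' : V ≤ W) (s : sec W),
    res h (res h' s) = res (h.trans h') s
  res_smul : ∀ {U V : Opens X.carrier} (h : U ≤ V) (a : X.O V) (s : sec V),
    res h (a • s) = X.res h a • res h s
  glue : ∀ (ι : Type w) (U : ι → Opens X.carrier) (s : ∀ i, sec (U i)),
    (∀ i j, res (inf_le_left : U i ⊓ U j ≤ U i) (s i) =
      res (inf_le_right : U i ⊓ U j ≤ U j) (s j)) →
    ∃! t : sec (⨆ i, U i), ∀ i, res (le_iSup U i) t = s i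

attribute [instance] ModuleSheaf.zero ModuleSheaf.act

section Sheaves

variable {X : MonoidScheme.{w}}

/-- An isomorphism `F|_U ≅ M~` of sheaves of modules on the affine open set `U` given by a chart
`Spec A ≅ U`. (Equivariant maps preserve base points.) -/
structure TildeIso (F : ModuleSheaf.{w, u} X) {A : Type w} [CommMonoidWithZero A]
    (c : AffineChart X.toMonoidalSpace A) (M : Type u) [Zero M] [MulActionWithZero A M] where
  equiv : ∀ V : Opens (Spec A), F.sec (c.img V) ≃ Tilde A M V
  equiv_smul : ∀ (V : Opens (Spec A)) (a : X.O (c.img V)) (s : F.sec (c.img V)),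
    equiv V (a • s) = c.iso V a • equiv V s
  equiv_res : ∀ {V W : Opens (Spec A)} (h : V ≤ W) (s : F.sec (c.img W)),
    equiv V (F.res (imgOpen_mono c.isOpenEmbedding h) s) = Tilde.res h (equiv W s)

/-- `F` is coherent: every point has an affine open neighbourhood on which `F` is isomorphic to
`M~` for a finitely generated module `M`. -/
def ModuleSheaf.IsCoherent (F : ModuleSheaf.{w, u} X) : Prop :=
  ∀ x : X.carrier, ∃ (A : Type w) (_ : CommMonoidWithZero A)
    (c : AffineChart X.toMonoidalSpace A), x ∈ Set.range c.toFun ∧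
    ∃ (M : Type u) (_ : Zero M) (_ : MulActionWithZero A M), IsFG A M ∧ Nonempty (TildeIso F c M)

/-- On every affine open subset, `F` is isomorphic to `M~` for a normal module `M`. -/
def ModuleSheaf.IsNormal (F : ModuleSheaf.{w, u} X) : Prop :=
  ∀ (A : Type w) [CommMonoidWithZero A] (c : AffineChart X.toMonoidalSpace A),
    ∃ (M : Type u) (_ : Zero M) (_ : MulActionWithZero A M),
      IsNormalModule A M ∧ Nonempty (TildeIso F c M)

/-- A morphism of sheaves of `O_X`-modules. -/
@[ext]
structure ModuleSheaf.Hom (F G : ModuleSheaf.{w, u} X) where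
  app : ∀ U : Opens X.carrier, F.sec U →[X.O U] G.sec U
  naturality : ∀ {U V : Opens X.carrier} (h : U ≤ V) (s : F.sec V),
    app U (F.res h s) = G.res h (app V s)

/-- A morphism is normal if it is a normal map on the sections over every affine open subset. -/
def ModuleSheaf.Hom.IsNormal {F G : ModuleSheaf.{w, u} X} (φ : F.Hom G) : Prop :=
  ∀ (A : Type w) [CommMonoidWithZero A] (c : AffineChart X.toMonoidalSpace A),
    IsNormalMap (φ.app (c.img ⊤))

/-! ### The category of normal coherent sheaves -/

variable (X) in
/-- The objects of `Coh_n(X)`: normal coherent sheaves on `X`. -/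
structure NormalCoh where
  sheaf : ModuleSheaf.{w, u} X
  isCoherent : sheaf.IsCoherent
  isNormal : sheaf.IsNormal

theorem map_base {A M N : Type*} [CommMonoidWithZero A] [Zero M] [Zero N] [MulActionWithZero A M]
    [MulActionWithZero A N] (f : M →[A] N) : f 0 = 0 := by
  have h := f.map_smul (0 : A) (0 : M)
  rwa [zero_smul, zero_smul] at h

theorem IsNormalMap.comp {M N P : Type*} [Zero N] [Zero P] {g : N → P} {f : M → N}
    (hg : IsNormalMap g) (hf : IsNormalMap f) (h0 : g 0 = 0) : IsNormalMap (g ∘ f) := by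
  intro x hx y hy hxy
  refine hf ?_ ?_ (hg hx hy hxy)
  · intro h
    exact hx (by simp [h, h0])
  · intro h
    exact hy (by simp [h, h0])

/-- The category `Coh_n(X)` of normal coherent sheaves and normal morphisms. -/
instance : Category (NormalCoh.{w, u} X) where
  Hom F G := {φ : F.sheaf.Hom G.sheaf // φ.IsNormal}
  id F := ⟨⟨fun U => MulActionHom.id _, fun _ _ => rfl⟩, fun _ _ _ _ _ _ _ h => h⟩
  comp φ ψ := ⟨⟨fun U => (ψ.1.app U).comp (φ.1.app U), fun h s => by
      simp [φ.1.naturality h s, ψ.1.naturality h]⟩,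
    fun A _ c => (ψ.2 A c).comp (φ.2 A c) (map_base _)⟩

/-! ### Extensions -/

/-- Exactness of `0 → G → E → F → 0` as sheaves of pointed sets. -/
structure IsShortExact {G E F : NormalCoh.{w, u} X} (i : G ⟶ E) (p : E ⟶ F) : Prop where
  injective : ∀ U, Function.Injective (i.1.app U)
  exact : ∀ U (e : E.sheaf.sec U), p.1.app U e = 0 ↔ ∃ g, i.1.app U g = e
  locally_surjective : ∀ U (s : F.sheaf.sec U), ∀ x ∈ U, ∃ (V : Opens X.carrier) (h : V ≤ U),
    x ∈ V ∧ ∃ e, p.1.app V e = F.sheaf.res h s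

/-- An extension of `F` by `G`: a short exact sequence `0 → G → E → F → 0` in `Coh_n(X)`. -/
structure Extension (F G : NormalCoh.{w, u} X) where
  mid : NormalCoh.{w, u} X
  i : G ⟶ mid
  p : mid ⟶ F
  exact : IsShortExact i p

/-- Equivalence of extensions of `F` by `G`: there is an isomorphism of the middle terms that
induces the identity on `F` and on `G`. -/
instance Extension.setoid (F G : NormalCoh.{w, u} X) : Setoid (Extension F G) where
  r e e' := ∃ θ : e.mid ≅ e'.mid, e.i ≫ θ.hom = e'.i ∧ θ.hom ≫ e'.p = e.p
  iseqv :=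
    ⟨fun e => ⟨Iso.refl _, by simp, by simp⟩,
     fun {e e'} ⟨θ, h, h'⟩ => ⟨θ.symm, by simp [← h], by simp [← h']⟩,
     fun {e e' e''} ⟨θ, h, h'⟩ ⟨η, k, k'⟩ =>
      ⟨θ ≪≫ η, by rw [← k, ← h]; simp, by rw [← h', ← k']; simp⟩⟩

/-- The set of equivalence classes of extensions of `F` by `G`. -/
def Ext (F G : NormalCoh.{w, u} X) : Type (max w (u + 1)) :=
  Quotient (Extension.setoid F G)

end Sheaves

/-! ### The projective line

`⟨t, t⁻¹⟩ = {0} ∪ {tⁿ : n ∈ ℤ}` is `WithZero (Multiplicative ℤ)`, with `t = WithZero.exp 1`.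
The projective line is obtained by gluing `U₀ = Spec ⟨t⟩` and `U_∞ = Spec ⟨t⁻¹⟩` along their
common open subset `Spec ⟨t, t⁻¹⟩`. It is written out here as a space of three points, and it is
proved below that it is covered by two affine charts, with the monoids `⟨t⟩` and `⟨t⁻¹⟩`. -/

/-- The monoid `⟨t, t⁻¹⟩`. -/
abbrev Laurent : Type := WithZero (Multiplicative ℤ)

/-- The submonoid `⟨g⟩ = {0, 1, g, g², …}` of `⟨t, t⁻¹⟩`. -/
def powers (g : Laurent) : Submonoid Laurent where
  carrier := {a | a = 0 ∨ ∃ n : ℕ, a = g ^ n}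
  one_mem' := Or.inr ⟨0, by simp⟩
  mul_mem' := by
    rintro a b (rfl | ⟨n, rfl⟩) hb
    · exact Or.inl (by simp)
    · rcases hb with rfl | ⟨m, rfl⟩
      · exact Or.inl (by simp)
      · exact Or.inr ⟨n + m, by rw [pow_add]⟩

namespace P1

/-- The points of the projective line: `0`, `∞` and the generic point `η`. -/
inductive Point : Type
  | zero
  | infty
  | eta

/-- The open sets are the empty set and the sets that contain `η`. -/
instance : TopologicalSpace Point where
  IsOpen U := U.Nonempty → Point.eta ∈ U
  isOpen_univ := fun _ => trivial
  isOpen_inter := fun _ _ hs ht ⟨x, hx, hx'⟩ => ⟨hs ⟨x, hx⟩, ht ⟨x, hx'⟩⟩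
  isOpen_sUnion := fun _ h ⟨_, U, hU, hx⟩ => ⟨U, hU, h U hU ⟨_, hx⟩⟩

theorem eta_mem {U : Opens Point} {x : Point} (hx : x ∈ U) : Point.eta ∈ U :=
  U.2 ⟨x, hx⟩

/-- The stalks of the structure sheaf, as submonoids of `⟨t, t⁻¹⟩`. -/
def stalk : Point → Submonoid Laurent
  | Point.zero => powers (WithZero.exp 1)
  | Point.infty => powers (WithZero.exp (-1))
  | Point.eta => ⊤

theorem zero_mem_stalk (x : Point) : (0 : Laurent) ∈ stalk x := by
  cases x
  · exact Or.inl rfl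
  · exact Or.inl rfl
  · trivial

/-- Sections over `U` of the structure sheaf: the constant functions on `U` with a value in
`⟨t, t⁻¹⟩` that belongs to the stalk at each point of `U` (a single section if `U = ∅`). -/
def O (U : Opens Point) : Type :=
  {s : U → Laurent // (∀ x, s x ∈ stalk x.1) ∧ ∀ x y, s x = s y}

instance (U : Opens Point) : Mul (O U) :=
  ⟨fun a b => ⟨fun x => a.1 x * b.1 x, fun x => (stalk x.1).mul_mem (a.2.1 x) (b.2.1 x),
    fun x y => congrArg₂ (· * ·) (a.2.2 x y) (b.2.2 x y)⟩⟩

instance (U : Opens Point) : CommMonoidWithZero (O U) where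
  one := ⟨fun _ => 1, fun x => (stalk x.1).one_mem, fun _ _ => rfl⟩
  zero := ⟨fun _ => 0, fun x => zero_mem_stalk x.1, fun _ _ => rfl⟩
  mul_assoc a b c := Subtype.ext (funext fun _ => mul_assoc _ _ _)
  one_mul a := Subtype.ext (funext fun _ => one_mul _)
  mul_one a := Subtype.ext (funext fun _ => mul_one _)
  mul_comm a b := Subtype.ext (funext fun _ => mul_comm _ _)
  zero_mul a := Subtype.ext (funext fun _ => zero_mul _)
  mul_zero a := Subtype.ext (funext fun _ => mul_zero _)

/-- The projective line as a monoidal space. -/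
abbrev space : MonoidalSpace.{0} where
  carrier := Point
  O := O
  res {U V} h :=
    { toFun := fun s => ⟨fun x => s.1 ⟨x.1, h x.2⟩, fun x => s.2.1 ⟨x.1, h x.2⟩,
        fun _ _ => s.2.2 _ _⟩
      map_zero' := rfl
      map_one' := rfl
      map_mul' := fun _ _ => rfl }
  res_self _ _ := rfl
  res_res _ _ _ := rfl
  glue ι U s hs := by
    have key : ∀ i j (x : U i) (y : U j), (s i).1 x = (s j).1 y := by
      intro i j x y
      have h := congrFun (congrArg Subtype.val (hs i j)) ⟨Point.eta, eta_mem x.2, eta_mem y.2⟩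
      exact ((s i).2.2 x ⟨Point.eta, eta_mem x.2⟩).trans
        (h.trans ((s j).2.2 ⟨Point.eta, eta_mem y.2⟩ y))
    choose k hk using fun x : (⨆ i, U i : Opens Point) => Opens.mem_iSup.1 x.2
    refine ⟨⟨fun x => (s (k x)).1 ⟨x.1, hk x⟩, fun x => (s (k x)).2.1 ⟨x.1, hk x⟩,
      fun x y => key _ _ _ _⟩, fun i => Subtype.ext (funext fun x => key _ _ _ _), ?_⟩
    intro t ht
    refine Subtype.ext (funext fun x => ?_)
    exact congrFun (congrArg Subtype.val (ht (k x))) ⟨x.1, hk x⟩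

section Chart

variable {x : Point} {g : Laurent}

/-- The monoid `⟨g⟩` with `g = t` or `g = t⁻¹`. -/
instance (g : Laurent) : CommMonoidWithZero (powers g) where
  zero := ⟨0, Or.inl rfl⟩
  zero_mul _ := Subtype.ext (zero_mul _)
  mul_zero _ := Subtype.ext (mul_zero _)

/-- The element `g` of `⟨g⟩`. -/
def gen (g : Laurent) : powers g := ⟨g, Or.inr ⟨1, by simp⟩⟩

theorem mem_of_ne_one (p : Spec (powers g)) (hp : gen g ∈ p.ideal) (a : powers g) (ha : a ≠ 1) :
    a ∈ p.ideal := by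
  obtain ⟨a, rfl | ⟨n, rfl⟩⟩ := a
  · exact p.zero_mem
  · cases n with
    | zero => exact absurd (Subtype.ext (by simp)) ha
    | succ n =>
      have h := p.ideal.mul_mem (gen g ^ n) hp
      convert h using 1
      exact Subtype.ext (by simp [gen, pow_succ])

theorem eq_zero_of_mem (p : Spec (powers g)) (hp : gen g ∉ p.ideal) (a : powers g)
    (ha : a ∈ p.ideal) : a = 0 := by
  obtain ⟨a, rfl | ⟨n, rfl⟩⟩ := a
  · rfl
  · exact absurd (by convert ha using 1; exact Subtype.ext (by simp [gen])) (p.primeCompl.pow_mem (x := gen g) hp n)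

theorem ne_zero_of_notMem (p : Spec (powers g)) {a : powers g} (ha : a ∉ p.ideal) :
    (a : Laurent) ≠ 0 := by
  intro h
  apply ha
  have : a = 0 := Subtype.ext h
  rw [this]
  exact p.zero_mem

/-- The prime ideal `{0}` of `⟨g⟩`. -/
def genericPrime (g : Laurent) : Spec (powers g) where
  ideal := ⟨{0}, by rintro a b rfl; exact mul_zero a⟩
  zero_mem := rfl
  one_notMem := fun h => one_ne_zero (α := Laurent) (congrArg Subtype.val h)
  mem_or_mem := by
    intro a b hab
    have h : (a : Laurent) * b = 0 := congrArg Subtype.val hab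
    exact (mul_eq_zero.1 h).imp (fun h => Subtype.ext h) (fun h => Subtype.ext h)

open Classical in
/-- The map `Spec ⟨g⟩ → P¹`: the closed point goes to `x` and the generic point to `η`. -/
noncomputable def chartMap (x : Point) (g : Laurent) (p : Spec (powers g)) : Point :=
  if gen g ∈ p.ideal then x else Point.eta

theorem chartMap_of_mem {p : Spec (powers g)} (hp : gen g ∈ p.ideal) : chartMap x g p = x :=
  if_pos hp

theorem chartMap_of_notMem {p : Spec (powers g)} (hp : gen g ∉ p.ideal) :
    chartMap x g p = Point.eta :=
  if_neg hp

theorem chartMap_injective (hx : x ≠ Point.eta) : Function.Injective (chartMap x g) := by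
  intro p q hpq
  have hiff : gen g ∈ p.ideal ↔ gen g ∈ q.ideal := by
    by_cases hp : gen g ∈ p.ideal <;> by_cases hq : gen g ∈ q.ideal
    · simp [hp, hq]
    · rw [chartMap_of_mem hp, chartMap_of_notMem hq] at hpq
      exact absurd hpq hx
    · rw [chartMap_of_notMem hp, chartMap_of_mem hq] at hpq
      exact absurd hpq.symm hx
    · simp [hp, hq]
  have key : ∀ p q : Spec (powers g), (gen g ∈ p.ideal ↔ gen g ∈ q.ideal) →
      p.ideal ≤ q.ideal := by
    intro p q h a ha
    by_cases hp : gen g ∈ p.ideal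
    · exact mem_of_ne_one q (h.1 hp) a (fun h1 => p.one_notMem (h1 ▸ ha))
    · rw [eq_zero_of_mem p hp a ha]
      exact q.zero_mem
  exact Spec.ext (le_antisymm (key p q hiff) (key q p hiff.symm))

theorem genericPrime_mem {V : Opens (Spec (powers g))} {p : Spec (powers g)} (hp : p ∈ V) :
    genericPrime g ∈ V := by
  obtain ⟨S, hS⟩ : ∃ S, (V : Set (Spec (powers g)))ᶜ = Spec.zeroLocus S := Spec.isOpen_iff.1 V.2
  by_contra hcon
  have h : genericPrime g ∈ (V : Set (Spec (powers g)))ᶜ := hcon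
  rw [hS] at h
  have hp' : p ∈ (V : Set (Spec (powers g)))ᶜ := by
    rw [hS]
    intro a ha
    have h0 : a = 0 := h a ha
    rw [h0]
    exact p.zero_mem
  exact hp' hp

theorem gen_notMem (hg : g ≠ 0) : gen g ∉ (genericPrime g).ideal :=
  fun h => hg (congrArg Subtype.val h)

theorem chartMap_isOpenEmbedding (hx : x ≠ Point.eta) (hg : g ≠ 0) :
    Topology.IsOpenEmbedding (chartMap x g) := by
  refine Topology.IsOpenEmbedding.of_continuous_injective_isOpenMap ?_ (chartMap_injective hx) ?_
  · refine continuous_def.2 fun U hU => ?_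
    by_cases hxU : x ∈ U
    · have h : chartMap x g ⁻¹' U = Set.univ := by
        refine Set.eq_univ_of_forall fun p => ?_
        by_cases hp : gen g ∈ p.ideal
        · simpa [Set.mem_preimage, chartMap_of_mem hp] using hxU
        · simpa [Set.mem_preimage, chartMap_of_notMem hp] using hU ⟨x, hxU⟩
      rw [h]
      exact isOpen_univ
    · rcases U.eq_empty_or_nonempty with rfl | hne
      · simp
      · refine Spec.isOpen_iff.2 ⟨{gen g}, ?_⟩
        ext p
        by_cases hp : gen g ∈ p.ideal
        · simp [Spec.zeroLocus, hp, chartMap_of_mem hp, hxU]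
        · simp [Spec.zeroLocus, hp, chartMap_of_notMem hp, hU hne]
  · rintro V hV ⟨_, p, hp, rfl⟩
    exact ⟨genericPrime g, genericPrime_mem (V := ⟨V, hV⟩) hp,
      chartMap_of_notMem (gen_notMem hg)⟩

/-- The embedding of the localization of `⟨g⟩` at a prime into `⟨t, t⁻¹⟩`. -/
noncomputable def val (p : Spec (powers g)) :
    OreLocalization p.primeCompl (powers g) →* Laurent :=
  OreLocalization.universalMulHom (powers g).subtype
    { toFun := fun f => Units.mk0 (f.1 : Laurent) (ne_zero_of_notMem p f.2)
      map_one' := Units.ext rfl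
      map_mul' := fun _ _ => Units.ext rfl }
    (fun _ => rfl)

open OreLocalization in
theorem val_apply (p : Spec (powers g)) (a : powers g) (f : p.primeCompl) :
    val p (a /ₒ f) = (f.1 : Laurent)⁻¹ * a := by
  change ((Units.mk0 (f.1 : Laurent) (ne_zero_of_notMem p f.2))⁻¹ : Units Laurent) * (a : Laurent) = _
  simp

open OreLocalization in
theorem val_injective (p : Spec (powers g)) : Function.Injective (val p) := by
  intro y z h
  induction y with
  | _ a f =>
  induction z with
  | _ b k =>
  rw [val_apply, val_apply] at h
  have hf := ne_zero_of_notMem p f.2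
  have hk := ne_zero_of_notMem p k.2
  refine oreDiv_eq_iff.2 ⟨f, k.1, Subtype.ext ?_, mul_comm _ _⟩
  change (f.1 : Laurent) * b = k.1 * a
  field_simp at h
  rw [← h, mul_comm]

open OreLocalization in
theorem val_mem (hst : stalk x = powers g) (p : Spec (powers g))
    (y : OreLocalization p.primeCompl (powers g)) : val p y ∈ stalk (chartMap x g p) := by
  by_cases hp : gen g ∈ p.ideal
  · rw [chartMap_of_mem hp, hst]
    induction y with
    | _ a f =>
    have hf : f.1 = 1 := by
      by_contra hf
      exact f.2 (mem_of_ne_one p hp _ hf)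
    rw [val_apply, hf]
    simp
  · rw [chartMap_of_notMem hp]
    trivial

theorem val_section {V : Opens (Spec (powers g))} (s : SpecO (powers g) V) (p : V) :
    val p.1 (s.1 p) = val _ (s.1 ⟨genericPrime g, genericPrime_mem p.2⟩) := by
  obtain ⟨W, hW, a, f, hp, h⟩ := s.2 p
  obtain ⟨h1, h1'⟩ := h p.1 hp
  obtain ⟨h2, h2'⟩ := h (genericPrime g) (genericPrime_mem hp)
  have e1 : s.1 p = _ := h1'
  rw [e1, h2', val_apply, val_apply]

theorem mem_img (hx : x ≠ Point.eta) (hg : g ≠ 0) {V : Opens (Spec (powers g))}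
    {p : Spec (powers g)} (hp : p ∈ V) :
    chartMap x g p ∈ imgOpen (chartMap_isOpenEmbedding hx hg) V :=
  ⟨p, hp, rfl⟩

/-- The point of `Spec ⟨g⟩` below a point of its image. -/
noncomputable def pre (hx : x ≠ Point.eta) (hg : g ≠ 0) {V : Opens (Spec (powers g))}
    (y : imgOpen (chartMap_isOpenEmbedding hx hg) V) : V :=
  ⟨Exists.choose (p := fun p => p ∈ V ∧ chartMap x g p = y.1) y.2,
    (Exists.choose_spec (p := fun p => p ∈ V ∧ chartMap x g p = y.1) y.2).1⟩

theorem chartMap_pre (hx : x ≠ Point.eta) (hg : g ≠ 0) {V : Opens (Spec (powers g))}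
    (y : imgOpen (chartMap_isOpenEmbedding hx hg) V) : chartMap x g (pre hx hg y).1 = y.1 :=
  (Exists.choose_spec (p := fun p => p ∈ V ∧ chartMap x g p = y.1) y.2).2

/-- The comparison of the structure sheaves on the chart `Spec ⟨g⟩`. -/
noncomputable def compare (hx : x ≠ Point.eta) (hg : g ≠ 0) (hst : stalk x = powers g)
    (V : Opens (Spec (powers g))) :
    SpecO (powers g) V →ₙ* O (imgOpen (chartMap_isOpenEmbedding hx hg) V) where
  toFun s := ⟨fun y => val (pre hx hg y).1 (s.1 (pre hx hg y)),
    fun y => chartMap_pre hx hg y ▸ val_mem hst _ (s.1 (pre hx hg y)),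
    fun y z => (val_section s (pre hx hg y)).trans (val_section s (pre hx hg z)).symm⟩
  map_mul' _ _ := Subtype.ext (funext fun _ => map_mul (val _) _ _)

theorem compare_apply (hx : x ≠ Point.eta) (hg : g ≠ 0) (hst : stalk x = powers g)
    (V : Opens (Spec (powers g))) (s : SpecO (powers g) V) (p : V)
    (y : imgOpen (chartMap_isOpenEmbedding hx hg) V) :
    (compare hx hg hst V s).1 y = val p.1 (s.1 p) := by
  rw [val_section s p]
  exact val_section s _

open OreLocalization in
theorem compare_bijective (hx : x ≠ Point.eta) (hg : g ≠ 0) (hst : stalk x = powers g)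
    (hgen : ∀ k : Laurent, ∃ n : ℕ, g ^ n * k ∈ powers g) (V : Opens (Spec (powers g))) :
    Function.Bijective (compare hx hg hst V) := by
  constructor
  · intro s s' h
    refine Subtype.ext (funext fun p => val_injective p.1 ?_)
    exact (compare_apply hx hg hst V s p ⟨_, mem_img hx hg p.2⟩).symm.trans
      ((congrFun (congrArg Subtype.val h) _).trans
        (compare_apply hx hg hst V s' p ⟨_, mem_img hx hg p.2⟩))
  · intro s
    rcases (V : Set (Spec (powers g))).eq_empty_or_nonempty with hV | ⟨p₀, hp₀⟩
    · refine ⟨⟨fun p => 1, fun p => ?_⟩, Subtype.ext (funext fun y => ?_)⟩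
      · exact absurd (show p.1 ∈ (V : Set _) from p.2) (by simp [hV])
      · exact absurd (show (pre hx hg y).1 ∈ (V : Set _) from (pre hx hg y).2) (by simp [hV])
    · obtain ⟨a, f, hf, hk⟩ : ∃ (a f : powers g), (∀ p ∈ V, f ∉ p.ideal) ∧
          (f : Laurent)⁻¹ * a = s.1 ⟨_, mem_img hx hg hp₀⟩ := by
        by_cases hc : ∃ p ∈ V, gen g ∈ p.ideal
        · obtain ⟨p, hp, hgp⟩ := hc
          refine ⟨⟨s.1 ⟨_, mem_img hx hg hp⟩, ?_⟩, 1, fun q _ => q.one_notMem, ?_⟩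
          · have h := s.2.1 ⟨_, mem_img hx hg hp⟩
            have e : stalk (chartMap x g p) = powers g := by rw [chartMap_of_mem hgp, hst]
            exact e.le h
          · simpa using s.2.2 _ _
        · push Not at hc
          obtain ⟨n, hn⟩ := hgen (s.1 ⟨_, mem_img hx hg hp₀⟩)
          refine ⟨⟨_, hn⟩, gen g ^ n, fun p hp => p.primeCompl.pow_mem (hc p hp) n, ?_⟩
          have hgn : g ^ n ≠ 0 := pow_ne_zero _ hg
          simp [gen, hgn]
      let r : SpecO (powers g) V := ⟨fun p => a /ₒ (⟨f, hf p.1 p.2⟩ : p.1.primeCompl),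
        fun p => ⟨V, le_rfl, a, f, p.2, fun q hq => ⟨hf q hq, rfl⟩⟩⟩
      refine ⟨r, Subtype.ext (funext fun y => ?_)⟩
      rw [compare_apply hx hg hst V r ⟨p₀, hp₀⟩ y, val_apply, hk]
      exact s.2.2 _ _

/-- The affine chart `Spec ⟨g⟩` around the closed point `x`. -/
noncomputable def chart (hx : x ≠ Point.eta) (hg : g ≠ 0) (hst : stalk x = powers g)
    (hgen : ∀ k : Laurent, ∃ n : ℕ, g ^ n * k ∈ powers g) : AffineChart space (powers g) where
  toFun := chartMap x g
  isOpenEmbedding := chartMap_isOpenEmbedding hx hg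
  iso V := (MulEquiv.ofBijective (compare hx hg hst V) (compare_bijective hx hg hst hgen V)).symm
  iso_res {V W} h s := by
    obtain ⟨s, rfl⟩ := (compare_bijective hx hg hst hgen W).2 s
    refine (MulEquiv.symm_apply_eq _).2 ?_
    have e : (MulEquiv.ofBijective (compare hx hg hst W)
      (compare_bijective hx hg hst hgen W)).symm (compare hx hg hst W s) = s :=
      MulEquiv.symm_apply_apply _ s
    refine Eq.trans ?_ (congrArg (fun r => compare hx hg hst V (Tilde.res h r)) e.symm)
    refine Subtype.ext (funext fun y => ?_)
    obtain ⟨_, p, hp, rfl⟩ := y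
    exact (compare_apply hx hg hst W s ⟨p, h hp⟩ ⟨_, mem_img hx hg (h hp)⟩).trans
      (compare_apply hx hg hst V (Tilde.res h s) ⟨p, hp⟩ ⟨_, mem_img hx hg hp⟩).symm

end Chart

theorem exp_one_gen (k : Laurent) :
    ∃ n : ℕ, WithZero.exp (1 : ℤ) ^ n * k ∈ powers (WithZero.exp 1) := by
  rcases eq_or_ne k 0 with rfl | hk
  · exact ⟨0, Or.inl (by simp)⟩
  · refine ⟨(WithZero.log k).natAbs, Or.inr ⟨((WithZero.log k).natAbs + WithZero.log k).toNat, ?_⟩⟩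
    rw [← WithZero.exp_log hk, ← WithZero.exp_nsmul, ← WithZero.exp_nsmul, ← WithZero.exp_add]
    congr 1
    simp only [WithZero.log_exp, nsmul_eq_mul, mul_one]
    omega

theorem exp_neg_one_gen (k : Laurent) :
    ∃ n : ℕ, WithZero.exp (-1 : ℤ) ^ n * k ∈ powers (WithZero.exp (-1)) := by
  rcases eq_or_ne k 0 with rfl | hk
  · exact ⟨0, Or.inl (by simp)⟩
  · refine ⟨(WithZero.log k).natAbs, Or.inr ⟨((WithZero.log k).natAbs - WithZero.log k).toNat, ?_⟩⟩
    rw [← WithZero.exp_log hk, ← WithZero.exp_nsmul, ← WithZero.exp_nsmul, ← WithZero.exp_add]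
    congr 1
    simp only [WithZero.log_exp, nsmul_eq_mul, mul_neg, mul_one]
    omega

/-- The chart `U₀ = Spec ⟨t⟩`, which contains the points `0` and `η`. -/
noncomputable def chartZero : AffineChart space (powers (WithZero.exp 1)) :=
  chart (x := Point.zero) (by simp) WithZero.exp_ne_zero rfl exp_one_gen

/-- The chart `U_∞ = Spec ⟨t⁻¹⟩`, which contains the points `∞` and `η`. -/
noncomputable def chartInfty : AffineChart space (powers (WithZero.exp (-1))) :=
  chart (x := Point.infty) (by simp) WithZero.exp_ne_zero rfl exp_neg_one_gen

/-- The prime ideal of `⟨g⟩` generated by `g`, for `g = t` or `g = t⁻¹`. -/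
def closedPrime (g : Laurent) (hg : ∀ n : ℕ, g ^ (n + 1) ≠ 1) : Spec (powers g) where
  ideal := ⟨{a | a ≠ 1}, by
    rintro ⟨a, ha⟩ ⟨b, hb⟩ hab h
    have hab' : b ≠ 1 := fun h => hab (Subtype.ext h)
    have h' : a * b = 1 := congrArg Subtype.val h
    rcases ha with rfl | ⟨n, rfl⟩
    · simp at h'
    · rcases hb with rfl | ⟨m, rfl⟩
      · simp at h'
      · cases m with
        | zero => simp at hab'
        | succ m => exact hg (n + m) (by rw [← h', ← pow_add, add_assoc])⟩
  zero_mem := fun h => zero_ne_one (α := Laurent) (congrArg Subtype.val h)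
  one_notMem := fun h => h rfl
  mem_or_mem := by
    intro a b hab
    by_contra! h
    obtain ⟨ha, hb⟩ := h
    have ha' : a = 1 := not_not.1 ha
    have hb' : b = 1 := not_not.1 hb
    exact hab (by rw [ha', hb', mul_one])

theorem gen_mem_closedPrime (g : Laurent) (hg : ∀ n : ℕ, g ^ (n + 1) ≠ 1) :
    gen g ∈ (closedPrime g hg).ideal := by
  intro h
  have h' : g = 1 := congrArg Subtype.val h
  exact hg 0 (by rw [h', one_pow])

end P1

/-- The projective line as a monoid scheme. -/
abbrev P1 : MonoidScheme.{0} where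
  toMonoidalSpace := P1.space
  locallyAffine := by
    have key : ∀ n : ℤ, n ≠ 0 → ∀ m : ℕ, (WithZero.exp n) ^ (m + 1) ≠ 1 := by
      intro n hn m h
      rw [← WithZero.exp_nsmul, ← WithZero.exp_zero, WithZero.exp_inj] at h
      simp only [nsmul_eq_mul, mul_eq_zero] at h
      omega
    have k1 := key 1 (by norm_num)
    have k2 := key (-1) (by norm_num)
    rintro (_ | _ | _)
    · exact ⟨_, _, P1.chartZero, P1.closedPrime _ k1,
        P1.chartMap_of_mem (P1.gen_mem_closedPrime _ k1)⟩
    · exact ⟨_, _, P1.chartInfty, P1.closedPrime _ k2,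
        P1.chartMap_of_mem (P1.gen_mem_closedPrime _ k2)⟩
    · exact ⟨_, _, P1.chartZero, P1.genericPrime _,
        P1.chartMap_of_notMem (P1.gen_notMem WithZero.exp_ne_zero)⟩

end FOne

/-! A sheaf on `P1` is controlled by its sections near the two closed points, which are modules over
⟨t⟩ and ⟨t⁻¹⟩, and by their common localization at the generic point η, where the two uniformizers
are inverse to each other. Near a closed point, coherence gives finitely many generators up to
powers of the uniformizer. Normality makes restriction to η injective off its kernel
(`eq_of_gres_eq`), and this kernel is finite (`finite_gres_eq_zero`).

Morphisms: a morphism is determined by the images of the generators. A generator near one closed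
point has a pole of some order N at the other, and no morphism can worsen it. The sections that are
regular at one point with a pole of order at most N at the other lie on finitely many finite orbit
segments (`finite_bounded_sections`, `finite_orbit_segment`).

Extensions: since the projection is normal, each stalk of the middle term is, as a pointed set, the
wedge of the stalks of G and F. The action and the restriction maps are then forced, except for the
product of the uniformizer with the lift of a nonzero f that it kills. This product is an element of
G (`connecting`), and normality of the middle term makes it zero or indivisible by the uniformizer.
There are finitely many such f and finitely many such values, and the values determine the extension
(`equivalent_of_connecting_eq`). -/

namespace FOne

/-! ### Sections of `M~` over the whole spectrum -/

section Const

variable {A : Type w} [CommMonoidWithZero A] {M : Type u} [Zero M] [MulActionWithZero A M]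

/-- The ideal of nonunits, the unique closed point of a nonempty spectrum. -/
def Spec.closedPoint (p : Spec A) : Spec A where
  ideal := ⟨{a | ¬ IsUnit a}, fun a b hb h => hb (isUnit_of_mul_isUnit_right h)⟩
  zero_mem := fun h => p.one_notMem (by
    have h' : (0 : A) = 1 := (isUnit_zero_iff.1 h)
    exact h' ▸ p.zero_mem)
  one_notMem := fun h => h isUnit_one
  mem_or_mem := by
    intro x y hxy
    by_contra! h
    obtain ⟨hx, hy⟩ := h
    exact hxy ((not_not.1 hx).mul (not_not.1 hy))

theorem Spec.notMem_closedPoint {p : Spec A} {a : A} :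
    a ∉ (Spec.closedPoint p).ideal ↔ IsUnit a :=
  not_not

/-- Every prime consists of nonunits, so every point specializes to the closed point. -/
theorem Spec.mem_of_closedPoint_mem {V : Opens (Spec A)} {p : Spec A}
    (h : Spec.closedPoint p ∈ V) (q : Spec A) : q ∈ V := by
  obtain ⟨S, hS⟩ : ∃ S, (V : Set (Spec A))ᶜ = Spec.zeroLocus S := Spec.isOpen_iff.1 V.2
  by_contra hq
  have hq' : q ∈ (V : Set (Spec A))ᶜ := hq
  rw [hS] at hq'
  have hc : Spec.closedPoint p ∈ (V : Set (Spec A))ᶜ := by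
    rw [hS]
    intro a ha hu
    obtain ⟨b, hb⟩ := hu.exists_left_inv
    exact q.one_notMem (hb ▸ q.ideal.mul_mem b (hq' a ha))
  exact hc h

open OreLocalization

/-- The section of `M~` given by an element of `M`. -/
def Tilde.const (U : Opens (Spec A)) (m : M) : Tilde A M U :=
  ⟨fun _ => m /ₒ 1, fun p => ⟨U, le_rfl, m, 1, p.2, fun q _ => ⟨q.one_notMem, rfl⟩⟩⟩

theorem Tilde.const_smul (U : Opens (Spec A)) (a : A) (m : M) :
    Tilde.const U (a • m) = (Tilde.const U a : SpecO A U) • Tilde.const U m := by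
  refine Subtype.ext (funext fun p => ?_)
  change (a • m) /ₒ 1 = (a /ₒ 1) • (m /ₒ 1)
  rw [oreDiv_smul_char a m 1 1 a 1 (by simp)]
  simp

/-- The complement of the closed prime is the group of units, so localizing there changes nothing.
The fraction that represents a section near the closed point represents it everywhere. -/
theorem Tilde.const_bijective (p : Spec A) :
    Function.Bijective (Tilde.const ⊤ : M → Tilde A M ⊤) := by
  constructor
  · intro m m' h
    have h' := congrFun (congrArg Subtype.val h) ⟨Spec.closedPoint p, trivial⟩
    obtain ⟨u, v, h1, h2⟩ := oreDiv_eq_iff.1 h'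
    have hv : (v : A) = u := by simpa using h2.symm
    have hu : IsUnit v := by
      rw [hv]
      exact Spec.notMem_closedPoint (p := p).1 u.2
    have h1' : (u : A) • m' = v • m := h1
    rw [← hv] at h1'
    exact (hu.smul_left_cancel.1 h1').symm
  · intro s
    obtain ⟨V, hV, m, f, hc, hs⟩ := s.2 ⟨Spec.closedPoint p, trivial⟩
    obtain ⟨hf, -⟩ := hs _ hc
    obtain ⟨u, rfl⟩ := Spec.notMem_closedPoint (p := p).1 hf
    refine ⟨(u⁻¹).1 • m, Subtype.ext (funext fun q => ?_)⟩
    obtain ⟨hq, e⟩ := hs q.1 (Spec.mem_of_closedPoint_mem (p := p) hc q.1)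
    refine Eq.trans ?_ e.symm
    refine oreDiv_eq_iff.2 ⟨1, u.1, ?_, by simp⟩
    simp [smul_smul]

end Const

/-! ### Transport of finite generation and normality along semilinear maps. -/

section Transport

variable {A : Type*} [CommMonoidWithZero A] {M : Type*} [Zero M] [MulActionWithZero A M]
  {B : Type*} [CommMonoidWithZero B] {N : Type*} [Zero N] [MulActionWithZero B N]
  {ψ : A → B} {e : M → N}

theorem map_zero_of_semilinear (hψ : Function.Surjective ψ)
    (h : ∀ a m, e (a • m) = ψ a • e m) : e 0 = 0 := by
  obtain ⟨a, ha⟩ := hψ 0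
  simpa [ha] using h a 0

theorem IsFG.of_semilinear (hM : IsFG A M) (he : Function.Surjective e)
    (h : ∀ a m, e (a • m) = ψ a • e m) : IsFG B N := by
  obtain ⟨S, hS, hg⟩ := hM
  refine ⟨e '' S, hS.image e, fun n => ?_⟩
  obtain ⟨m, rfl⟩ := he n
  obtain ⟨a, s, hs, rfl⟩ := hg m
  exact ⟨ψ a, e s, ⟨s, hs, rfl⟩, h a s⟩

theorem IsNormalModule.of_semilinear (hM : IsNormalModule A M) (hψ : Function.Surjective ψ)
    (he : Function.Bijective e) (h : ∀ a m, e (a • m) = ψ a • e m) : IsNormalModule B N := by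
  have e0 : e 0 = 0 := map_zero_of_semilinear hψ h
  intro b x hx y hy hxy
  obtain ⟨a, rfl⟩ := hψ b
  obtain ⟨x, rfl⟩ := he.2 x
  obtain ⟨y, rfl⟩ := he.2 y
  simp only [Set.mem_ofPred_eq, ← h] at hx hy hxy
  congr 1
  refine hM a ?_ ?_ (he.1 hxy)
  · intro h0
    exact hx (by simp only at h0; rw [h0, e0])
  · intro h0
    exact hy (by simp only at h0; rw [h0, e0])

end Transport

/-! ### Sections over an affine open set as a finitely generated or normal module. -/

section GlobalSections

variable {X : MonoidScheme.{w}} {F : ModuleSheaf.{w, u} X} {A : Type w} [CommMonoidWithZero A]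
  {c : AffineChart X.toMonoidalSpace A} {M : Type u} [Zero M] [MulActionWithZero A M]

theorem TildeIso.symm_smul (φ : TildeIso F c M) (V : Opens (Spec A)) (a : A) (m : M) :
    (φ.equiv V).symm (Tilde.const V (a • m)) =
      (c.iso V).symm (Tilde.const V a) • (φ.equiv V).symm (Tilde.const V m) := by
  rw [Equiv.symm_apply_eq, φ.equiv_smul]
  simp [Tilde.const_smul]

theorem IsFG.sections (hM : IsFG A M) (φ : TildeIso F c M) (p : Spec A) :
    IsFG (X.O (c.img ⊤)) (F.sec (c.img ⊤)) :=
  hM.of_semilinear (ψ := fun a => (c.iso ⊤).symm (Tilde.const ⊤ a))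
    (e := fun m => (φ.equiv ⊤).symm (Tilde.const ⊤ m))
    ((φ.equiv ⊤).symm.surjective.comp (Tilde.const_bijective p).2) (φ.symm_smul ⊤)

theorem IsNormalModule.sections (hM : IsNormalModule A M) (φ : TildeIso F c M) (p : Spec A) :
    IsNormalModule (X.O (c.img ⊤)) (F.sec (c.img ⊤)) :=
  hM.of_semilinear (ψ := fun a => (c.iso ⊤).symm (Tilde.const ⊤ a))
    (e := fun m => (φ.equiv ⊤).symm (Tilde.const ⊤ m))
    ((c.iso ⊤).symm.surjective.comp (Tilde.const_bijective p).2)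
    ((φ.equiv ⊤).symm.bijective.comp (Tilde.const_bijective p)) (φ.symm_smul ⊤)

end GlobalSections

namespace P1

/-! ### Minimal neighbourhoods and uniformizers -/

/-- The smallest open neighbourhood of a point. -/
def nhd (x : Point) : Opens Point :=
  ⟨{x, Point.eta}, fun _ => Or.inr rfl⟩

theorem mem_nhd (x : Point) : x ∈ nhd x := Or.inl rfl

theorem eta_mem_nhd (x : Point) : Point.eta ∈ nhd x := Or.inr rfl

theorem nhd_le {x : Point} {U : Opens Point} (hx : x ∈ U) : nhd x ≤ U := by
  rintro y (rfl | rfl)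
  · exact hx
  · exact eta_mem hx

theorem nhd_eta_le (x : Point) : nhd Point.eta ≤ nhd x := nhd_le (eta_mem_nhd x)

/-- The value of a section of the structure sheaf. -/
def eval {U : Opens Point} (x : U) : O U →*₀ Laurent where
  toFun a := a.1 x
  map_zero' := rfl
  map_one' := rfl
  map_mul' _ _ := rfl

theorem eval_injective {U : Opens Point} (x : U) : Function.Injective (eval x) := by
  intro a b h
  refine Subtype.ext (funext fun y => ?_)
  exact (a.2.2 y x).trans (Eq.trans h (b.2.2 x y))

/-- The exponents of the chosen uniformizers. -/
def deg : Point → ℤ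
  | Point.zero => 1
  | Point.infty => -1
  -- Arbitrary nonzero value: it keeps `unif` and `unifEta` defined at every point.
  | Point.eta => 1

theorem deg_ne_zero (x : Point) : deg x ≠ 0 := by
  cases x <;> simp [deg]

theorem stalk_eq {x : Point} (hx : x ≠ Point.eta) : stalk x = powers (WithZero.exp (deg x)) := by
  cases x
  · rfl
  · rfl
  · exact absurd rfl hx

theorem exp_deg_mem (x : Point) : WithZero.exp (deg x) ∈ stalk x := by
  cases x
  · exact Or.inr ⟨1, (pow_one _).symm⟩
  · exact Or.inr ⟨1, (pow_one _).symm⟩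
  · trivial

/-- The uniformizer `t` or `t⁻¹` on the minimal neighbourhood of a point. -/
def unif (x : Point) : O (nhd x) :=
  ⟨fun _ => WithZero.exp (deg x), by
    rintro ⟨y, rfl | rfl⟩
    · exact exp_deg_mem y
    · trivial, fun _ _ => rfl⟩

theorem eq_zero_or_pow {x : Point} (hx : x ≠ Point.eta) (a : O (nhd x)) :
    a = 0 ∨ ∃ n : ℕ, a = unif x ^ n := by
  have h := a.2.1 ⟨x, mem_nhd x⟩
  simp only [stalk_eq hx] at h
  refine h.imp (fun h => eval_injective ⟨x, mem_nhd x⟩ h) ?_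
  rintro ⟨n, hn⟩
  refine ⟨n, eval_injective ⟨x, mem_nhd x⟩ ?_⟩
  rw [map_pow]
  exact hn

theorem eq_zero_or_isUnit (a : O (nhd Point.eta)) : a = 0 ∨ IsUnit a := by
  rcases eq_or_ne (a.1 ⟨Point.eta, mem_nhd _⟩) 0 with h | h
  · exact Or.inl (eval_injective ⟨Point.eta, mem_nhd _⟩ h)
  · refine Or.inr (.of_mul_eq_one
      ⟨fun _ => (a.1 ⟨Point.eta, mem_nhd _⟩)⁻¹, ?_, fun _ _ => rfl⟩
      (eval_injective ⟨Point.eta, mem_nhd _⟩ (mul_inv_cancel₀ h)))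
    rintro ⟨y, rfl | rfl⟩ <;> trivial

/-- The uniformizer at `x` as a unit at the generic point. -/
def unifEta (x : Point) : (O (nhd Point.eta))ˣ where
  val := space.res (nhd_eta_le x) (unif x)
  inv := ⟨fun _ => WithZero.exp (-deg x), by rintro ⟨y, rfl | rfl⟩ <;> trivial, fun _ _ => rfl⟩
  val_inv := by
    refine eval_injective ⟨Point.eta, mem_nhd _⟩ ?_
    change WithZero.exp (deg x) * WithZero.exp (-deg x) = 1
    rw [← WithZero.exp_add]
    simp
  inv_val := by
    refine eval_injective ⟨Point.eta, mem_nhd _⟩ ?_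
    change WithZero.exp (-deg x) * WithZero.exp (deg x) = 1
    rw [← WithZero.exp_add]
    simp

theorem unifEta_mul_unifEta {x y : Point} (h : deg x + deg y = 0) :
    (unifEta x : O (nhd Point.eta)) * unifEta y = 1 := by
  refine eval_injective ⟨Point.eta, mem_nhd _⟩ ?_
  change WithZero.exp (deg x) * WithZero.exp (deg y) = 1
  rw [← WithZero.exp_add, h]
  simp

/-! ### The affine charts around the closed points -/

/-- The affine chart `Spec ⟨g⟩` with `g = t` or `g = t⁻¹` around a closed point. -/
noncomputable def closedChart {x : Point} (hx : x ≠ Point.eta) :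
    AffineChart space (powers (WithZero.exp (deg x))) :=
  chart hx WithZero.exp_ne_zero (stalk_eq hx) (by
    cases x
    · exact exp_one_gen
    · exact exp_neg_one_gen
    · exact absurd rfl hx)

theorem exp_pow_ne_one {n : ℤ} (hn : n ≠ 0) (m : ℕ) :
    (WithZero.exp n : Laurent) ^ (m + 1) ≠ 1 := by
  intro h
  rw [← WithZero.exp_nsmul, ← WithZero.exp_zero, WithZero.exp_inj] at h
  simp only [nsmul_eq_mul, mul_eq_zero] at h
  omega

/-- The generic point of `Spec ⟨g⟩` as an open subset. -/
def genericOpen (g : Laurent) : Opens (Spec (powers g)) :=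
  ⟨{p | gen g ∉ p.ideal}, Spec.isOpen_iff.2 ⟨{gen g}, by ext p; simp [Spec.zeroLocus]⟩⟩

theorem eq_genericPrime {g : Laurent} {p : Spec (powers g)} (hp : gen g ∉ p.ideal) :
    p = genericPrime g := by
  refine Spec.ext (SetLike.ext fun a => ⟨fun h => eq_zero_of_mem p hp a h, fun h => ?_⟩)
  have h' : a = 0 := h
  exact h' ▸ p.zero_mem

theorem img_top {x : Point} (hx : x ≠ Point.eta) : (closedChart hx).img ⊤ = nhd x := by
  refine le_antisymm ?_ (nhd_le ?_)
  · rintro _ ⟨p, -, rfl⟩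
    by_cases hp : gen _ ∈ p.ideal
    · exact Or.inl (chartMap_of_mem hp)
    · exact Or.inr (chartMap_of_notMem hp)
  · exact ⟨closedPrime _ (exp_pow_ne_one (deg_ne_zero x)), trivial,
      chartMap_of_mem (gen_mem_closedPrime _ _)⟩

theorem img_genericOpen {x : Point} (hx : x ≠ Point.eta) :
    (closedChart hx).img (genericOpen _) = nhd Point.eta := by
  refine le_antisymm ?_ (nhd_le ?_)
  · rintro _ ⟨p, hp, rfl⟩
    exact Or.inr (chartMap_of_notMem hp)
  · exact ⟨genericPrime _, gen_notMem WithZero.exp_ne_zero,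
      chartMap_of_notMem (gen_notMem WithZero.exp_ne_zero)⟩

theorem iso_symm_const {x : Point} (hx : x ≠ Point.eta) (V : Opens _)
    (a : powers (WithZero.exp (deg x))) (y : (closedChart hx).img V) :
    eval y (((closedChart hx).iso V).symm (Tilde.const V a)) = a := by
  change val _ (OreLocalization.oreDiv a 1) = _
  rw [val_apply]
  simp

/-- An affine open subset containing a closed point is its minimal neighbourhood. -/
theorem img_top_eq_nhd {x : Point} (hx : x ≠ Point.eta) {A : Type} [CommMonoidWithZero A]
    (c : AffineChart space A) (h : x ∈ Set.range c.toFun) : c.img ⊤ = nhd x := by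
  obtain ⟨p, rfl⟩ := h
  have key : ∀ q : Spec A, c.toFun q ∈ nhd (c.toFun (Spec.closedPoint p)) := by
    intro q
    let V : Opens (Spec A) := ⟨c.toFun ⁻¹' (nhd (c.toFun (Spec.closedPoint p))),
      (nhd _).2.preimage c.isOpenEmbedding.continuous⟩
    exact Spec.mem_of_closedPoint_mem (V := V) (p := p) (mem_nhd (c.toFun (Spec.closedPoint p))) q
  -- The closed point `x` lies in the minimal neighbourhood of the image of the closed point of the
  -- spectrum; as `x` is not η, it is that image.
  have hp : c.toFun p = c.toFun (Spec.closedPoint p) := (key p).resolve_right hx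
  refine le_antisymm ?_ (nhd_le ⟨p, trivial, rfl⟩)
  rintro _ ⟨q, -, rfl⟩
  rw [hp]
  exact key q

end P1

theorem ModuleSheaf.res_zero {X : MonoidScheme.{w}} (F : ModuleSheaf.{w, u} X)
    {U V : Opens X.carrier} (h : U ≤ V) : F.res h 0 = 0 := by
  have h' := F.res_smul h 0 0
  rwa [map_zero, zero_smul, zero_smul] at h'

theorem ModuleSheaf.Hom.app_zero {X : MonoidScheme.{w}} {F G : ModuleSheaf.{w, u} X}
    (φ : F.Hom G) (U : Opens X.carrier) : φ.app U 0 = 0 :=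
  map_base (φ.app U)

namespace P1

/-! ### Sections near a point -/

instance (F : ModuleSheaf.{0, u} P1) (U : Opens Point) : MulActionWithZero (O U) (F.sec U) :=
  F.act U

section Restriction

variable (F : ModuleSheaf.{0, u} P1)

/-- Restriction of sections near `x` to the generic point. -/
def gres (x : Point) (s : F.sec (nhd x)) : F.sec (nhd Point.eta) :=
  F.res (nhd_eta_le x) s

variable {F}

theorem gres_zero (x : Point) : gres F x 0 = 0 := F.res_zero _

theorem gres_pow_smul (x : Point) (n : ℕ) (s : F.sec (nhd x)) :
    gres F x (unif x ^ n • s) = (unifEta x : O (nhd Point.eta)) ^ n • gres F x s := by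
  refine (F.res_smul _ _ _).trans ?_
  rw [map_pow]
  rfl

theorem unifEta_pow_smul_injective (x : Point) (n : ℕ) :
    Function.Injective fun v : F.sec (nhd Point.eta) =>
      (unifEta x : O (nhd Point.eta)) ^ n • v := by
  intro v w h
  exact ((unifEta x).isUnit.pow n).smul_left_cancel.1 h

theorem unifEta_pow_smul_eq_zero (x : Point) (n : ℕ) {v : F.sec (nhd Point.eta)} :
    (unifEta x : O (nhd Point.eta)) ^ n • v = 0 ↔ v = 0 := by
  refine ⟨fun h => unifEta_pow_smul_injective x n ?_, fun h => by rw [h, smul_zero]⟩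
  simpa using h

theorem gres_eq_of_pow_smul_eq {x : Point} {n : ℕ} {s s' : F.sec (nhd x)}
    (h : unif x ^ n • s = unif x ^ n • s') : gres F x s = gres F x s' := by
  refine unifEta_pow_smul_injective x n ?_
  simp only [← gres_pow_smul, h]

theorem Hom.app_gres {F G : ModuleSheaf.{0, u} P1} (φ : F.Hom G) (x : Point)
    (s : F.sec (nhd x)) : φ.app _ (gres F x s) = gres G x (φ.app _ s) :=
  φ.naturality _ s

end Restriction

/-! ### Generic sections as the localization of the sections near a closed point. -/

section Localization

open OreLocalization

variable {F : ModuleSheaf.{0, u} P1} {x : Point} {hx : x ≠ Point.eta}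
  {M : Type u} [Zero M] [MulActionWithZero (powers (WithZero.exp (deg x))) M]

theorem gen_pow_eq {g : Laurent} {p : Spec (powers g)} {a : powers g} (ha : a ∉ p.ideal) :
    ∃ n : ℕ, a = gen g ^ n := by
  obtain ⟨a, rfl | ⟨n, rfl⟩⟩ := a
  · exact absurd p.zero_mem ha
  · exact ⟨n, Subtype.ext (by simp [gen])⟩

theorem eval_gen_pow (n : ℕ) (U : Opens Point) (y : U) (h : U ≤ nhd x) :
    eval y (space.res h (unif x ^ n)) = (gen (WithZero.exp (deg x)) ^ n : powers _) := by
  rw [map_pow, map_pow]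
  simp [gen]
  rfl

theorem iso_symm_gen_pow (n : ℕ) (V : Opens _) (U : Opens Point) (hU : (closedChart hx).img V = U)
    (h : U ≤ nhd x) (hne : Point.eta ∈ U) :
    ((closedChart hx).iso V).symm (Tilde.const V (gen _ ^ n)) =
      space.res (hU.trans_le h) (unif x ^ n) := by
  subst hU
  refine eval_injective ⟨_, hne⟩ ?_
  rw [iso_symm_const, eval_gen_pow]

/-- A denominator at the generic prime is a nonzero element of ⟨g⟩, hence a power of the generator.
`U` and `V` are variables with equations because sections over equal open sets have different types.
-/
theorem TildeIso.exists_pow_smul_eq_res (φ : TildeIso F (closedChart hx) M) {U V : Opens Point}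
    (hU : (closedChart hx).img (genericOpen _) = U) (hV : (closedChart hx).img ⊤ = V)
    (hUV : U ≤ V) (hVx : V ≤ nhd x) (hne : Point.eta ∈ U) (v : F.sec U) :
    ∃ (n : ℕ) (s : F.sec V),
      space.res (hUV.trans hVx) (unif x ^ n) • v = F.res hUV s := by
  subst hU hV
  obtain ⟨W, hW, m, f, hpW, h⟩ := (φ.equiv _ v).2
    ⟨genericPrime _, gen_notMem WithZero.exp_ne_zero⟩
  obtain ⟨hf, e⟩ := h _ hpW
  obtain ⟨n, rfl⟩ := gen_pow_eq hf
  refine ⟨n, (φ.equiv ⊤).symm (Tilde.const ⊤ m), (φ.equiv _).injective ?_⟩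
  have h1 : φ.equiv _ (F.res hUV ((φ.equiv ⊤).symm (Tilde.const ⊤ m))) =
      Tilde.const (genericOpen _) m := by
    refine (φ.equiv_res (show genericOpen _ ≤ ⊤ from le_top) _).trans ?_
    rw [Equiv.apply_symm_apply]
    rfl
  rw [h1, φ.equiv_smul]
  have h2 := iso_symm_gen_pow (hx := hx) n (genericOpen _) _ rfl (hUV.trans hVx) hne
  rw [MulEquiv.symm_apply_eq] at h2
  rw [← h2]
  refine Subtype.ext (funext fun ⟨q, hq⟩ => ?_)
  obtain rfl := eq_genericPrime hq
  change (gen _ ^ n /ₒ 1) • ((φ.equiv _ v).1 ⟨genericPrime _, _⟩) = m /ₒ 1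
  rw [e, oreDiv_smul_char _ m 1 ⟨_, hf⟩ 1 1 (by simp)]
  rw [one_smul, mul_one]

/-- The other half of the localization property: two fractions with denominator 1 agree exactly when
some power of the generator equalizes the numerators. -/
theorem TildeIso.exists_pow_smul_eq (φ : TildeIso F (closedChart hx) M) {U V : Opens Point}
    (hU : (closedChart hx).img (genericOpen _) = U) (hV : (closedChart hx).img ⊤ = V)
    (hUV : U ≤ V) (hVx : V ≤ nhd x) (hne : Point.eta ∈ U) {s s' : F.sec V}
    (h : F.res hUV s = F.res hUV s') :
    ∃ n : ℕ, space.res hVx (unif x ^ n) • s = space.res hVx (unif x ^ n) • s' := by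
  subst hU hV
  obtain ⟨m, hm⟩ := (Tilde.const_bijective (genericPrime _)).2 (φ.equiv ⊤ s)
  obtain ⟨m', hm'⟩ := (Tilde.const_bijective (genericPrime _)).2 (φ.equiv ⊤ s')
  have h1 := congrArg (φ.equiv (genericOpen _)) h
  have e1 := φ.equiv_res (show genericOpen _ ≤ ⊤ from le_top) s
  have e2 := φ.equiv_res (show genericOpen _ ≤ ⊤ from le_top) s'
  rw [← hm] at e1
  rw [← hm'] at e2
  have h2 := (e1.symm.trans h1).trans e2
  have h3 := congrFun (congrArg Subtype.val h2)
    ⟨genericPrime _, gen_notMem WithZero.exp_ne_zero⟩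
  obtain ⟨u, v, k1, k2⟩ := oreDiv_eq_iff.1 h3
  have hv : v = u := by simpa using k2.symm
  have k1' : u.1 • m' = v • m := k1
  rw [← hv] at k1'
  obtain ⟨n, rfl⟩ := gen_pow_eq (hv ▸ u.2)
  refine ⟨n, (φ.equiv ⊤).injective ?_⟩
  have h4 := iso_symm_gen_pow (hx := hx) n ⊤ _ rfl hVx (hUV hne)
  rw [MulEquiv.symm_apply_eq] at h4
  rw [φ.equiv_smul, φ.equiv_smul, ← h4, ← hm, ← hm', ← Tilde.const_smul, ← Tilde.const_smul, k1']

end Localization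

/-! ### Consequences of normality and coherence near a closed point. -/

section NormalCoh

variable (F : NormalCoh.{0, u} P1) {x : Point} (hx : x ≠ Point.eta)

include hx

theorem isNormalModule_nhd : IsNormalModule (O (nhd x)) (F.sheaf.sec (nhd x)) := by
  obtain ⟨M, _, _, hM, ⟨φ⟩⟩ := F.isNormal _ (closedChart hx)
  have h := hM.sections φ (genericPrime _)
  -- `img_top` is not definitional, so the open set is abstracted before it is substituted.
  generalize hU : (closedChart hx).img ⊤ = U at h
  rw [img_top hx] at hU
  subst hU
  exact h

/-- The chart given by coherence may differ from `closedChart`, but its image is the minimal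
neighbourhood, where a section of the structure sheaf is zero or a power of `unif x`. -/
theorem exists_finite_generators : ∃ S : Set (F.sheaf.sec (nhd x)), S.Finite ∧
    ∀ s : F.sheaf.sec (nhd x), ∃ r ∈ S, s = 0 ∨ ∃ n : ℕ, s = unif x ^ n • r := by
  obtain ⟨A, _, c, hc, M, _, _, hM, ⟨φ⟩⟩ := F.isCoherent x
  have h := hM.sections φ hc.choose
  generalize hU : c.img ⊤ = U at h
  rw [img_top_eq_nhd hx c hc] at hU
  subst hU
  obtain ⟨S, hS, hg⟩ := h
  refine ⟨S, hS, fun s => ?_⟩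
  obtain ⟨a, r, hr, rfl⟩ := hg s
  refine ⟨r, hr, (eq_zero_or_pow hx a).imp ?_ ?_⟩
  · rintro rfl
    exact zero_smul _ _
  · rintro ⟨n, rfl⟩
    exact ⟨n, rfl⟩

theorem exists_pow_smul_eq_gres (v : F.sheaf.sec (nhd Point.eta)) :
    ∃ (n : ℕ) (s : F.sheaf.sec (nhd x)),
      (unifEta x : O (nhd Point.eta)) ^ n • v = gres F.sheaf x s := by
  obtain ⟨M, _, _, hM, ⟨φ⟩⟩ := F.isNormal _ (closedChart hx)
  obtain ⟨n, s, h⟩ := TildeIso.exists_pow_smul_eq_res φ (img_genericOpen hx) (img_top hx)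
    (nhd_eta_le x) le_rfl (mem_nhd _) v
  refine ⟨n, s, ?_⟩
  rw [map_pow] at h
  exact h

theorem gres_eq_iff {s s' : F.sheaf.sec (nhd x)} :
    gres F.sheaf x s = gres F.sheaf x s' ↔ ∃ n : ℕ, unif x ^ n • s = unif x ^ n • s' := by
  refine ⟨fun h => ?_, fun ⟨n, h⟩ => gres_eq_of_pow_smul_eq h⟩
  obtain ⟨M, _, _, hM, ⟨φ⟩⟩ := F.isNormal _ (closedChart hx)
  exact TildeIso.exists_pow_smul_eq φ (img_genericOpen hx) (img_top hx)
    (nhd_eta_le x) le_rfl (mem_nhd _) h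

theorem gres_eq_zero_iff {s : F.sheaf.sec (nhd x)} :
    gres F.sheaf x s = 0 ↔ ∃ n : ℕ, unif x ^ n • s = 0 := by
  rw [← gres_zero (F := F.sheaf) x, gres_eq_iff F hx]
  simp

end NormalCoh

end P1

/-! ### Finiteness of pieces of orbits -/

section Orbit

variable {R V : Type*} [Monoid R] [MulAction R V]

/-- A repetition makes the orbit eventually periodic: an exponent n ≥ j can be lowered by j - i. -/
theorem finite_range_pow_smul {u : R} {a : V} {i j : ℕ} (hij : i < j)
    (h : u ^ i • a = u ^ j • a) : (Set.range fun n : ℕ => u ^ n • a).Finite := by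
  refine ((Set.finite_Iio j).image fun n : ℕ => u ^ n • a).subset ?_
  rintro _ ⟨n, rfl⟩
  induction n using Nat.strong_induction_on with
  | _ n ih =>
  rcases lt_or_ge n j with hn | hn
  · exact ⟨n, hn, rfl⟩
  · have e : u ^ n • a = u ^ (n - j + i) • a := by
      rw [pow_add, mul_smul, h, ← mul_smul, ← pow_add, Nat.sub_add_cancel hn]
    have h' := ih (n - j + i) (by omega)
    simp only at h' ⊢
    rwa [e]

/-- If the orbit of `a` repeats, it is finite. Otherwise `b` is hit at most once, at some exponent
K, and k + n = K bounds n. -/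
theorem finite_orbit_segment (u : R) (a b : V) :
    {v : V | ∃ n k : ℕ, v = u ^ n • a ∧ u ^ k • v = b}.Finite := by
  by_cases h : ∃ i j : ℕ, i < j ∧ u ^ i • a = u ^ j • a
  · obtain ⟨i, j, hij, h⟩ := h
    refine (finite_range_pow_smul hij h).subset ?_
    rintro _ ⟨n, -, rfl, -⟩
    exact ⟨n, rfl⟩
  · have hinj : Function.Injective fun n : ℕ => u ^ n • a := by
      intro i j hij
      by_contra hne
      rcases lt_or_gt_of_ne hne with hlt | hlt
      · exact h ⟨i, j, hlt, hij⟩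
      · exact h ⟨j, i, hlt, hij.symm⟩
    by_cases hK : ∃ K : ℕ, u ^ K • a = b
    · obtain ⟨K, rfl⟩ := hK
      refine ((Set.finite_Iic K).image fun n : ℕ => u ^ n • a).subset ?_
      rintro _ ⟨n, k, rfl, hk⟩
      rw [← mul_smul, ← pow_add] at hk
      have e : k + n = K := hinj hk
      exact ⟨n, by simp only [Set.mem_Iic]; omega, rfl⟩
    · convert Set.finite_empty
      rw [Set.eq_empty_iff_forall_notMem]
      rintro _ ⟨n, k, rfl, hk⟩
      exact hK ⟨k + n, by rw [pow_add, mul_smul, hk]⟩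

end Orbit

namespace P1

/-! ### Gluing over minimal neighbourhoods -/

theorem iSup_nhd (U : Opens Point) : ⨆ x : U, nhd x.1 = U := by
  refine le_antisymm (iSup_le fun x => nhd_le x.2) fun x hx => ?_
  exact Opens.mem_iSup.2 ⟨⟨x, hx⟩, mem_nhd x⟩

theorem inf_nhd_le {x y : Point} (h : x ≠ y) : nhd x ⊓ nhd y ≤ nhd Point.eta := by
  rintro z ⟨hx | hx, hy | hy⟩
  · exact absurd (hx.symm.trans hy) h
  · exact Or.inr hy
  · exact Or.inr hx
  · exact Or.inr hx

/-- Minimal neighbourhoods of distinct points meet inside that of η, so compatibility need only be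
checked there. -/
theorem existsUnique_glue (F : ModuleSheaf.{0, u} P1) (U : Opens Point)
    (s : ∀ x : U, F.sec (nhd x)) (hs : ∀ x y : U, gres F x (s x) = gres F y (s y)) :
    ∃! t : F.sec U, ∀ x : U, F.res (nhd_le x.2) t = s x := by
  have h := F.glue U (fun x => nhd x) s fun x y => by
    by_cases hxy : x = y
    · subst hxy
      rfl
    · have hle := inf_nhd_le fun h => hxy (Subtype.ext h)
      have h' := congrArg (F.res hle) (hs x y)
      simp only [gres, F.res_res] at h'
      exact h'
  have key : ∀ W : Opens Point, W = U → ∀ hW : ∀ x : U, nhd x.1 ≤ W,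
      (∃! t : F.sec W, ∀ x : U, F.res (hW x) t = s x) →
      ∃! t : F.sec U, ∀ x : U, F.res (nhd_le x.2) t = s x := by
    rintro W rfl hW h
    exact h
  exact key _ (iSup_nhd U) (fun x => le_iSup (fun x : U => nhd x.1) x) h

theorem eq_of_res_nhd_eq (F : ModuleSheaf.{0, u} P1) {U : Opens Point} {s t : F.sec U}
    (h : ∀ x (hx : x ∈ U), F.res (nhd_le hx) s = F.res (nhd_le hx) t) : s = t := by
  refine (existsUnique_glue F U (fun x => F.res (nhd_le x.2) t) fun x y => ?_).unique
    (fun x => h x.1 x.2) (fun x => rfl)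
  simp only [gres, F.res_res]

/-! ### Finiteness of torsion -/

section Torsion

variable (F : NormalCoh.{0, u} P1) {x : Point} (hx : x ≠ Point.eta)

include hx

/-- A nonzero element of the kernel is a multiple of a generator that vanishes at η; some power of
the uniformizer kills that generator, so its orbit is finite. -/
theorem finite_gres_eq_zero : {s : F.sheaf.sec (nhd x) | gres F.sheaf x s = 0}.Finite := by
  obtain ⟨S, hS, hg⟩ := exists_finite_generators F hx
  have hfin : ∀ r ∈ S, {s : F.sheaf.sec (nhd x) | gres F.sheaf x r = 0 ∧
      ∃ n : ℕ, s = unif x ^ n • r}.Finite := by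
    intro r _
    by_cases h : gres F.sheaf x r = 0
    · obtain ⟨n, hn⟩ := (gres_eq_zero_iff F hx).1 h
      refine (finite_range_pow_smul (u := unif x) (a := r) (Nat.lt_succ_self n) ?_).subset ?_
      · rw [pow_succ', mul_smul, hn, smul_zero]
      · rintro _ ⟨-, k, rfl⟩
        exact ⟨k, rfl⟩
    · simp [h]
  refine ((Set.finite_singleton 0).union (hS.biUnion hfin)).subset fun s hs => ?_
  obtain ⟨r, hr, rfl | ⟨n, rfl⟩⟩ := hg s
  · exact Or.inl rfl
  · refine Or.inr (Set.mem_biUnion hr ⟨?_, n, rfl⟩)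
    have hs' : gres F.sheaf x (unif x ^ n • r) = 0 := hs
    rwa [gres_pow_smul, unifEta_pow_smul_eq_zero] at hs'

/-- Some power of the uniformizer equalizes the two sections without killing them, and it acts by a
normal map. -/
theorem eq_of_gres_eq {s s' : F.sheaf.sec (nhd x)} (h : gres F.sheaf x s = gres F.sheaf x s')
    (h0 : gres F.sheaf x s ≠ 0) : s = s' := by
  obtain ⟨n, hn⟩ := (gres_eq_iff F hx).1 h
  refine isNormalModule_nhd F hx (unif x ^ n) ?_ ?_ hn
  · exact fun h' => h0 ((gres_eq_zero_iff F hx).2 ⟨n, h'⟩)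
  · exact fun h' => h0 (h.trans ((gres_eq_zero_iff F hx).2 ⟨n, h'⟩))

theorem finite_gres_preimage {B : Set (F.sheaf.sec (nhd Point.eta))} (hB : B.Finite) :
    (gres F.sheaf x ⁻¹' B).Finite := by
  refine hB.preimage' fun v _ => ?_
  by_cases hv : v = 0
  · subst hv
    exact finite_gres_eq_zero F hx
  · refine Set.Subsingleton.finite fun s hs s' hs' => ?_
    have h : gres F.sheaf x s = v := hs
    have h' : gres F.sheaf x s' = v := hs'
    exact eq_of_gres_eq F hx (h.trans h'.symm) (h ▸ hv)

end Torsion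

/-! ### Finiteness of the set of morphisms -/

section Hom

theorem exists_opposite {x : Point} (hx : x ≠ Point.eta) :
    ∃ y, y ≠ Point.eta ∧ deg x + deg y = 0 := by
  cases x
  · exact ⟨Point.infty, by simp, rfl⟩
  · exact ⟨Point.zero, by simp, rfl⟩
  · exact absurd rfl hx

/-- The sections at the generic point with prescribed poles form a finite set. -/
theorem finite_bounded_sections (G : NormalCoh.{0, u} P1) {x y : Point} (hx : x ≠ Point.eta)
    (hy : y ≠ Point.eta) (hxy : deg x + deg y = 0) (N : ℕ) :
    {v | (∃ s, v = gres G.sheaf x s) ∧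
      ∃ s, (unifEta y : O (nhd Point.eta)) ^ N • v = gres G.sheaf y s}.Finite := by
  obtain ⟨S, hS, hgS⟩ := exists_finite_generators G hx
  obtain ⟨S', hS', hgS'⟩ := exists_finite_generators G hy
  refine ((Set.finite_singleton 0).union (hS.biUnion fun r _ => hS'.biUnion fun r' _ =>
    finite_orbit_segment (unifEta x : O (nhd Point.eta)) (gres G.sheaf x r)
      ((unifEta x : O (nhd Point.eta)) ^ N • gres G.sheaf y r'))).subset ?_
  rintro _ ⟨⟨s, rfl⟩, s', hs'⟩
  obtain ⟨r, hr, rfl | ⟨n, rfl⟩⟩ := hgS s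
  · exact Or.inl (gres_zero x)
  obtain ⟨r', hr', rfl | ⟨k, rfl⟩⟩ := hgS' s'
  · rw [gres_zero, unifEta_pow_smul_eq_zero] at hs'
    exact Or.inl hs'
  · refine Or.inr (Set.mem_biUnion hr (Set.mem_biUnion hr' ⟨n, k, gres_pow_smul x n r, ?_⟩))
    have h1 := unifEta_mul_unifEta hxy
    have h2 : ∀ m : ℕ, (unifEta x : O (nhd Point.eta)) ^ m * unifEta y ^ m = 1 := fun m => by
      rw [← mul_pow, h1, one_pow]
    rw [gres_pow_smul y] at hs'
    -- Multiplying by the power N + k of `unifEta x`, the inverse of `unifEta y`, turns the pole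
    -- condition at `y` into a forward orbit condition for `unifEta x`.
    have h3 := congrArg
      (fun v => ((unifEta x : O (nhd Point.eta)) ^ N * (unifEta x : O (nhd Point.eta)) ^ k) • v) hs'
    generalize gres G.sheaf x (unif x ^ n • r) = v at h3 ⊢
    rw [smul_smul, smul_smul, mul_right_comm, h2, one_mul, mul_assoc, h2, mul_one] at h3
    exact h3

/-- The bound N on the pole of `r` at the opposite point depends on `r` alone, so `B` serves all
morphisms at once. -/
theorem exists_finite_values (F G : NormalCoh.{0, u} P1) {x : Point} (hx : x ≠ Point.eta)
    (r : F.sheaf.sec (nhd x)) : ∃ B : Set (G.sheaf.sec (nhd x)), B.Finite ∧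
      ∀ φ : F.sheaf.Hom G.sheaf, φ.app (nhd x) r ∈ B := by
  obtain ⟨y, hy, hxy⟩ := exists_opposite hx
  obtain ⟨N, m, hm⟩ := exists_pow_smul_eq_gres F hy (gres F.sheaf x r)
  refine ⟨_, finite_gres_preimage G hx (finite_bounded_sections G hx hy hxy N), fun φ => ?_⟩
  refine ⟨⟨_, rfl⟩, φ.app _ m, ?_⟩
  rw [← Hom.app_gres, ← Hom.app_gres, ← hm]
  exact ((φ.app _).map_smul _ _).symm

theorem hom_ext {F : NormalCoh.{0, u} P1} {G : ModuleSheaf.{0, u} P1} {φ ψ : F.sheaf.Hom G}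
    (h : ∀ x, x ≠ Point.eta → ∀ s, φ.app (nhd x) s = ψ.app (nhd x) s) : φ = ψ := by
  have h' : ∀ x s, φ.app (nhd x) s = ψ.app (nhd x) s := by
    intro x s
    by_cases hx : x = Point.eta
    · subst hx
      have h0 : Point.zero ≠ Point.eta := by simp
      obtain ⟨n, m, hm⟩ := exists_pow_smul_eq_gres F h0 s
      refine unifEta_pow_smul_injective Point.zero n ?_
      refine ((φ.app _).map_smul _ _).symm.trans (Eq.trans ?_ ((ψ.app _).map_smul _ _))
      exact (congrArg _ hm).trans ((Hom.app_gres φ _ m).trans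
        ((congrArg _ (h _ h0 m)).trans ((Hom.app_gres ψ _ m).symm.trans (congrArg _ hm.symm))))
    · exact h x hx s
  refine ModuleSheaf.Hom.ext (funext fun U => MulActionHom.ext fun s => ?_)
  refine eq_of_res_nhd_eq G fun x hx => ?_
  rw [← φ.naturality, ← ψ.naturality]
  exact h' x _

instance : Finite Point :=
  Finite.of_surjective (fun b : Option Bool => b.elim Point.eta fun b => cond b Point.zero Point.infty)
    (by
      rintro (_ | _ | _)
      · exact ⟨some true, rfl⟩
      · exact ⟨some false, rfl⟩
      · exact ⟨none, rfl⟩)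

theorem finite_hom (F G : NormalCoh.{0, u} P1) : Finite (F ⟶ G) := by
  choose S hS hg using fun x : {x : Point // x ≠ Point.eta} => exists_finite_generators F x.2
  choose B hB hφ using fun (x : {x : Point // x ≠ Point.eta}) (r : S x) =>
    exists_finite_values F G x.2 r.1
  have := fun x => (hS x).to_subtype
  have := fun x r => (hB x r).to_subtype
  refine Finite.of_injective
    (fun (φ : F ⟶ G) (x : {x : Point // x ≠ Point.eta}) (r : S x) =>
      (⟨φ.1.app _ r.1, hφ x r φ.1⟩ : B x r)) fun φ ψ h => Subtype.ext (hom_ext fun x hx s => ?_)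
  obtain ⟨r, hr, rfl | ⟨n, rfl⟩⟩ := hg ⟨x, hx⟩ s
  · exact (φ.1.app_zero _).trans (ψ.1.app_zero _).symm
  · have e : φ.1.app _ r = ψ.1.app _ r :=
      congrArg Subtype.val (congrFun (congrFun h ⟨x, hx⟩) ⟨r, hr⟩)
    exact ((φ.1.app _).map_smul _ _).trans ((congrArg _ e).trans ((ψ.1.app _).map_smul _ _).symm)

end Hom

/-! ### The stalks of an extension -/

section Stalks

variable {F G : NormalCoh.{0, u} P1} (e : Extension F G)

/-- A neighbourhood of `x` inside the minimal one is the minimal one, so local surjectivity is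
surjectivity on these sections. -/
theorem exists_lift (x : Point) (f : F.sheaf.sec (nhd x)) : ∃ a, e.p.1.app (nhd x) a = f := by
  obtain ⟨V, hV, hx, a, ha⟩ := e.exact.locally_surjective _ f x (mem_nhd x)
  obtain rfl := le_antisymm hV (nhd_le hx)
  exact ⟨a, ha.trans (F.sheaf.res_self _ _)⟩

theorem p_i (U : Opens Point) (g : G.sheaf.sec U) : e.p.1.app U (e.i.1.app U g) = 0 :=
  (e.exact.exact U _).2 ⟨g, rfl⟩

theorem isNormalMap_nhd {E F : NormalCoh.{0, u} P1} (φ : E ⟶ F) (x : Point) :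
    IsNormalMap (φ.1.app (nhd x)) := by
  have closed : ∀ x, x ≠ Point.eta → IsNormalMap (φ.1.app (nhd x)) := by
    intro x hx
    have h := φ.2 _ (closedChart hx)
    generalize hU : (closedChart hx).img ⊤ = U at h
    rw [img_top hx] at hU
    subst hU
    exact h
  by_cases hx : x = Point.eta
  · subst hx
    have h0 : Point.zero ≠ Point.eta := by simp
    intro v hv w hw hvw
    obtain ⟨n, s, hs⟩ := exists_pow_smul_eq_gres E h0 v
    obtain ⟨m, s', hs'⟩ := exists_pow_smul_eq_gres E h0 w
    -- Cross-multiplying by the exponents `m` and `n` gives both sections the common denominator of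
    -- exponent n + m, which reduces the claim to the closed point `Point.zero`.
    have e1 := congrArg (φ.1.app _) (gres_pow_smul _ m s)
    have e2 := congrArg (φ.1.app _) (gres_pow_smul _ n s')
    rw [← hs, smul_smul, ← pow_add] at e1
    rw [← hs', smul_smul, ← pow_add, add_comm n m] at e2
    have k1 := (Hom.app_gres φ.1 _ _).symm.trans (e1.trans ((φ.1.app _).map_smul _ _))
    have k2 := (Hom.app_gres φ.1 _ _).symm.trans (e2.trans ((φ.1.app _).map_smul _ _))
    have hvw' : φ.1.app _ v = φ.1.app _ w := hvw
    have k3 : gres F.sheaf Point.zero (φ.1.app _ (unif Point.zero ^ m • s)) ≠ 0 := by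
      rw [k1]
      exact fun h => hv ((unifEta_pow_smul_eq_zero _ _).1 h)
    have k4 := eq_of_gres_eq F h0 (k1.trans ((congrArg _ hvw').trans k2.symm)) k3
    have k5 : φ.1.app _ (unif Point.zero ^ m • s) ≠ 0 := fun h => k3 (by rw [h, gres_zero])
    have k6 := closed _ h0 k5 (show φ.1.app _ _ ≠ 0 from fun h => k5 (k4.trans h)) k4
    have k7 := congrArg (gres E.sheaf _) k6
    rw [gres_pow_smul, gres_pow_smul, ← hs, ← hs', smul_smul, smul_smul, ← pow_add, ← pow_add,
      add_comm n m] at k7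
    exact unifEta_pow_smul_injective _ _ k7
  · exact closed x hx

/-- As `f` is nonzero and the projection is normal, the lift is unique, so `g` does not depend on
it. -/
theorem exists_connecting (x : Point) (f : {f : F.sheaf.sec (nhd x) // f ≠ 0 ∧ unif x • f = 0}) :
    ∃ g, ∀ a, e.p.1.app _ a = f.1 → e.i.1.app _ g = unif x • a := by
  obtain ⟨a, ha⟩ := exists_lift e x f.1
  obtain ⟨g, hg⟩ := (e.exact.exact (nhd x) (unif x • a)).1
    (((e.p.1.app _).map_smul _ _).trans ((congrArg _ ha).trans f.2.2))
  refine ⟨g, fun b hb => ?_⟩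
  have hab : a = b := isNormalMap_nhd e.p x (show e.p.1.app _ a ≠ 0 from ha ▸ f.2.1)
    (show e.p.1.app _ b ≠ 0 from hb ▸ f.2.1) (ha.trans hb.symm)
  exact hab ▸ hg

/-- The element of `G` obtained from a section of `F` killed by the uniformizer at `x` by lifting
it to the middle term and multiplying the lift by the uniformizer. -/
noncomputable def connecting (x : Point)
    (f : {f : F.sheaf.sec (nhd x) // f ≠ 0 ∧ unif x • f = 0}) : G.sheaf.sec (nhd x) :=
  (exists_connecting e x f).choose

theorem connecting_spec {x : Point} (f : {f : F.sheaf.sec (nhd x) // f ≠ 0 ∧ unif x • f = 0})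
    {a : e.mid.sheaf.sec (nhd x)} (ha : e.p.1.app _ a = f.1) :
    e.i.1.app _ (connecting e x f) = unif x • a :=
  (exists_connecting e x f).choose_spec a ha

/-- If a nonzero value were divisible, normality of the middle term would identify the lift of `f`
with an element of G, forcing `f` to vanish. -/
theorem connecting_indivisible {x : Point} (hx : x ≠ Point.eta)
    (f : {f : F.sheaf.sec (nhd x) // f ≠ 0 ∧ unif x • f = 0}) (g : G.sheaf.sec (nhd x))
    (h : connecting e x f = unif x • g) : connecting e x f = 0 := by
  by_contra h0
  obtain ⟨a, ha⟩ := exists_lift e x f.1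
  have h1 := connecting_spec e f ha
  have h2 : unif x • e.i.1.app _ g = unif x • a :=
    ((e.i.1.app _).map_smul _ _).symm.trans ((congrArg _ h.symm).trans h1)
  have h3 : unif x • a ≠ 0 := by
    rw [← h1]
    exact fun h => h0 (e.exact.injective _ (h.trans (e.i.1.app_zero _).symm))
  have h4 : e.i.1.app _ g = a := isNormalModule_nhd e.mid hx (unif x)
    (show unif x • e.i.1.app _ g ≠ 0 from h2 ▸ h3) h3 h2
  exact f.2.1 (ha.symm.trans (h4 ▸ p_i e _ g))

/-- A positive power of the uniformizer times a generator is divisible, so only zero and the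
generators remain. -/
theorem finite_indivisible (G : NormalCoh.{0, u} P1) {x : Point} (hx : x ≠ Point.eta) :
    {g : G.sheaf.sec (nhd x) | ∀ g', g = unif x • g' → g = 0}.Finite := by
  obtain ⟨S, hS, hg⟩ := exists_finite_generators G hx
  refine ((Set.finite_singleton 0).union hS).subset fun s hs => ?_
  obtain ⟨r, hr, rfl | ⟨n, rfl⟩⟩ := hg s
  · exact Or.inl rfl
  · cases n with
    | zero => exact Or.inr (by simpa using hr)
    | succ n => exact Or.inl (hs (unif x ^ n • r) (by rw [smul_smul, ← pow_succ']))

theorem finite_killed (F : NormalCoh.{0, u} P1) {x : Point} (hx : x ≠ Point.eta) :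
    Finite {f : F.sheaf.sec (nhd x) // f ≠ 0 ∧ unif x • f = 0} :=
  ((finite_gres_eq_zero F hx).subset fun f hf =>
    (gres_eq_zero_iff F hx).2 ⟨1, by simpa using hf.2⟩).to_subtype

end Stalks

/-! ### Comparison of two extensions -/

section Compare

variable {F G : NormalCoh.{0, u} P1} {e e' : Extension F G}

/-- Two sections of the middle terms correspond to each other: either they come from the same
section of `G`, or they have the same nonzero image in `F`. -/
def Corr (e e' : Extension F G) (U : Opens Point) (a : e.mid.sheaf.sec U)
    (b : e'.mid.sheaf.sec U) : Prop :=
  (∃ g, e.i.1.app U g = a ∧ e'.i.1.app U g = b) ∨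
    (e.p.1.app U a ≠ 0 ∧ e.p.1.app U a = e'.p.1.app U b)

theorem Corr.symm {U : Opens Point} {a : e.mid.sheaf.sec U} {b : e'.mid.sheaf.sec U}
    (h : Corr e e' U a b) : Corr e' e U b a := by
  rcases h with ⟨g, h, h'⟩ | ⟨h, h'⟩
  · exact Or.inl ⟨g, h', h⟩
  · exact Or.inr ⟨h' ▸ h, h'.symm⟩

theorem Corr.p_eq {U : Opens Point} {a : e.mid.sheaf.sec U} {b : e'.mid.sheaf.sec U}
    (h : Corr e e' U a b) : e.p.1.app U a = e'.p.1.app U b := by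
  rcases h with ⟨g, rfl, rfl⟩ | ⟨-, h⟩
  · rw [p_i, p_i]
  · exact h

/-- The fibre of the projection over 0 is a copy of G, and normality makes every other fibre a
single element. -/
theorem corr_existsUnique (x : Point) (a : e.mid.sheaf.sec (nhd x)) :
    ∃! b, Corr e e' (nhd x) a b := by
  by_cases h : e.p.1.app _ a = 0
  · obtain ⟨g, rfl⟩ := (e.exact.exact _ a).1 h
    refine ⟨_, Or.inl ⟨g, rfl, rfl⟩, ?_⟩
    rintro b (⟨g', hg', rfl⟩ | ⟨h', -⟩)
    · rw [e.exact.injective _ hg']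
    · exact absurd h h'
  · obtain ⟨b, hb⟩ := exists_lift e' x (e.p.1.app _ a)
    refine ⟨b, Or.inr ⟨h, hb.symm⟩, ?_⟩
    rintro b' (⟨g', rfl, rfl⟩ | ⟨-, h'⟩)
    · exact absurd (p_i e _ g') h
    · exact isNormalMap_nhd e'.p x (show e'.p.1.app _ b' ≠ 0 from h' ▸ h)
        (show e'.p.1.app _ b ≠ 0 from hb.symm ▸ h) (h'.symm.trans hb.symm)

/-- The correspondence can only break when `r` kills a nonzero image in F, for then the product
falls into G. -/
theorem Corr.smul_of_p_ne {U : Opens Point} {a : e.mid.sheaf.sec U} {b : e'.mid.sheaf.sec U}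
    (h : Corr e e' U a b) (r : O U) (h0 : e.p.1.app U a ≠ 0 → r • e.p.1.app U a ≠ 0) :
    Corr e e' U (r • a) (r • b) := by
  rcases h with ⟨g, rfl, rfl⟩ | ⟨h, h'⟩
  · exact Or.inl ⟨r • g, (e.i.1.app U).map_smul r g, (e'.i.1.app U).map_smul r g⟩
  · have k := (e.p.1.app U).map_smul r a
    refine Or.inr ⟨fun hz => h0 h (k.symm.trans hz), ?_⟩
    exact k.trans ((congrArg (r • ·) h').trans ((e'.p.1.app U).map_smul r b).symm)

theorem Corr.smul_eta {a : e.mid.sheaf.sec (nhd Point.eta)} {b : e'.mid.sheaf.sec (nhd Point.eta)}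
    (h : Corr e e' _ a b) (r : O (nhd Point.eta)) : Corr e e' _ (r • a) (r • b) := by
  rcases eq_zero_or_isUnit r with rfl | hr
  · rw [zero_smul, zero_smul]
    exact Or.inl ⟨0, e.i.1.app_zero _, e'.i.1.app_zero _⟩
  · refine h.smul_of_p_ne r fun h0 hz => h0 (hr.smul_left_cancel.1 (hz.trans (smul_zero r).symm))

variable (hc : ∀ x, x ≠ Point.eta → connecting e x = connecting e' x)

include hc

theorem Corr.unif_smul {x : Point} (hx : x ≠ Point.eta) {a : e.mid.sheaf.sec (nhd x)}
    {b : e'.mid.sheaf.sec (nhd x)} (h : Corr e e' _ a b) :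
    Corr e e' _ (unif x • a) (unif x • b) := by
  by_cases h0 : e.p.1.app _ a ≠ 0 ∧ unif x • e.p.1.app _ a = 0
  · refine Or.inl ⟨connecting e x ⟨_, h0⟩, connecting_spec e _ rfl, ?_⟩
    rw [hc x hx]
    exact connecting_spec e' _ h.p_eq.symm
  · exact h.smul_of_p_ne _ fun h1 h2 => h0 ⟨h1, h2⟩

theorem Corr.smul {x : Point} {a : e.mid.sheaf.sec (nhd x)} {b : e'.mid.sheaf.sec (nhd x)}
    (h : Corr e e' _ a b) (r : O (nhd x)) : Corr e e' _ (r • a) (r • b) := by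
  by_cases hx : x = Point.eta
  · subst hx
    exact h.smul_eta r
  · rcases eq_zero_or_pow hx r with rfl | ⟨n, rfl⟩
    · rw [zero_smul, zero_smul]
      exact Or.inl ⟨0, e.i.1.app_zero _, e'.i.1.app_zero _⟩
    · induction n with
      | zero => simpa using h
      | succ n ih =>
        rw [pow_succ', mul_smul, mul_smul]
        exact ih.unif_smul hc hx

theorem Corr.gres {x : Point} {a : e.mid.sheaf.sec (nhd x)} {b : e'.mid.sheaf.sec (nhd x)}
    (h : Corr e e' _ a b) : Corr e e' _ (gres _ x a) (gres _ x b) := by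
  have from_G : ∀ {a : e.mid.sheaf.sec (nhd x)} {b : e'.mid.sheaf.sec (nhd x)},
      (∃ g, e.i.1.app _ g = a ∧ e'.i.1.app _ g = b) →
        Corr e e' _ (P1.gres _ x a) (P1.gres _ x b) := by
    rintro _ _ ⟨g, rfl, rfl⟩
    exact Or.inl ⟨P1.gres _ x g, Hom.app_gres _ _ _, Hom.app_gres _ _ _⟩
  rcases id h with h1 | ⟨h1, h2⟩
  · exact from_G h1
  by_cases h0 : P1.gres F.sheaf x (e.p.1.app _ a) = 0
  · by_cases hx : x = Point.eta
    · subst hx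
      exact absurd ((F.sheaf.res_self _ _).symm.trans h0) h1
    · obtain ⟨n, hn⟩ := (gres_eq_zero_iff F hx).1 h0
      rcases h.smul hc (unif x ^ n) with h3 | ⟨h3, -⟩
      · have h4 := from_G h3
        rw [gres_pow_smul, gres_pow_smul] at h4
        have h5 := h4.smul_eta (((unifEta x ^ n)⁻¹ : (O (nhd Point.eta))ˣ) : O (nhd Point.eta))
        rw [← Units.val_pow_eq_pow_val, smul_smul, smul_smul, Units.inv_mul, one_smul,
          one_smul] at h5
        exact h5
      · exact absurd (((e.p.1.app _).map_smul _ _).trans hn) h3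
  · refine Or.inr ⟨?_, ?_⟩
    · rwa [Hom.app_gres]
    · rw [Hom.app_gres, Hom.app_gres, h2]

omit hc

/-- Sections over an arbitrary open set that correspond to each other near every point. -/
def LocCorr (e e' : Extension F G) (U : Opens Point) (a : e.mid.sheaf.sec U)
    (b : e'.mid.sheaf.sec U) : Prop :=
  ∀ (x : Point) (hx : x ∈ U),
    Corr e e' (nhd x) (e.mid.sheaf.res (nhd_le hx) a) (e'.mid.sheaf.res (nhd_le hx) b)

theorem LocCorr.symm {U : Opens Point} {a : e.mid.sheaf.sec U} {b : e'.mid.sheaf.sec U}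
    (h : LocCorr e e' U a b) : LocCorr e' e U b a :=
  fun x hx => (h x hx).symm

theorem LocCorr.res {U V : Opens Point} (hUV : U ≤ V) {a : e.mid.sheaf.sec V}
    {b : e'.mid.sheaf.sec V} (h : LocCorr e e' V a b) :
    LocCorr e e' U (e.mid.sheaf.res hUV a) (e'.mid.sheaf.res hUV b) := by
  intro x hx
  rw [e.mid.sheaf.res_res, e'.mid.sheaf.res_res]
  exact h x (hUV hx)

theorem LocCorr.unique {U : Opens Point} {a : e.mid.sheaf.sec U} {b b' : e'.mid.sheaf.sec U}
    (h : LocCorr e e' U a b) (h' : LocCorr e e' U a b') : b = b' :=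
  eq_of_res_nhd_eq _ fun x hx => (corr_existsUnique x _).unique (h x hx) (h' x hx)

theorem locCorr_i (U : Opens Point) (g : G.sheaf.sec U) :
    LocCorr e e' U (e.i.1.app U g) (e'.i.1.app U g) :=
  fun _ hx => Or.inl ⟨G.sheaf.res (nhd_le hx) g, e.i.1.naturality _ _, e'.i.1.naturality _ _⟩

theorem LocCorr.p_eq {U : Opens Point} {a : e.mid.sheaf.sec U} {b : e'.mid.sheaf.sec U}
    (h : LocCorr e e' U a b) : e.p.1.app U a = e'.p.1.app U b := by
  refine eq_of_res_nhd_eq F.sheaf fun x hx => ?_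
  rw [← e.p.1.naturality, ← e'.p.1.naturality]
  exact (h x hx).p_eq

include hc

theorem LocCorr.smul {U : Opens Point} {a : e.mid.sheaf.sec U} {b : e'.mid.sheaf.sec U}
    (h : LocCorr e e' U a b) (r : O U) : LocCorr e e' U (r • a) (r • b) := by
  intro x hx
  have k := (h x hx).smul hc (space.res (nhd_le hx) r)
  have k1 := e.mid.sheaf.res_smul (nhd_le hx) r a
  have k2 := e'.mid.sheaf.res_smul (nhd_le hx) r b
  exact k1 ▸ k2 ▸ k

theorem exists_locCorr (U : Opens Point) (a : e.mid.sheaf.sec U) :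
    ∃ b, LocCorr e e' U a b := by
  choose s hs _ using fun x : U =>
    corr_existsUnique (e := e) (e' := e') x.1 (e.mid.sheaf.res (nhd_le x.2) a)
  -- The local partners agree at η because both correspond there to the restriction of `a`.
  obtain ⟨b, hb, -⟩ := existsUnique_glue e'.mid.sheaf U s fun x y => by
    have h1 := (hs x).gres hc
    have h2 := (hs y).gres hc
    simp only [P1.gres, e.mid.sheaf.res_res] at h1 h2
    exact (corr_existsUnique _ _).unique h1 h2
  refine ⟨b, fun x hx => ?_⟩
  rw [hb ⟨x, hx⟩]
  exact hs ⟨x, hx⟩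

/-- The morphism between the middle terms whose graph is the correspondence. -/
noncomputable def corrHom : e.mid.sheaf.Hom e'.mid.sheaf where
  app U :=
    { toFun := fun a => (exists_locCorr hc U a).choose
      map_smul' := fun r a => (exists_locCorr hc U (r • a)).choose_spec.unique
        ((exists_locCorr hc U a).choose_spec.smul hc r) }
  naturality h s := (exists_locCorr hc _ _).choose_spec.unique
    ((exists_locCorr hc _ s).choose_spec.res h)

theorem corrHom_spec (U : Opens Point) (a : e.mid.sheaf.sec U) :
    LocCorr e e' U a ((corrHom hc).app U a) :=
  (exists_locCorr hc U a).choose_spec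

/-- The correspondence is symmetric with unique partners, so the map is even injective. -/
theorem corrHom_isNormal : (corrHom hc).IsNormal := by
  intro A _ c a _ b _ h
  have h1 := corrHom_spec hc (c.img ⊤) a
  have h2 := corrHom_spec hc (c.img ⊤) b
  rw [h] at h1
  exact h1.symm.unique h2.symm

theorem equivalent_of_connecting_eq : e ≈ e' := by
  have hc' := fun x hx => (hc x hx).symm
  refine ⟨⟨⟨corrHom hc, corrHom_isNormal hc⟩, ⟨corrHom hc', corrHom_isNormal hc'⟩, ?_, ?_⟩, ?_, ?_⟩
  all_goals refine Subtype.ext (ModuleSheaf.Hom.ext (funext fun U => MulActionHom.ext fun a => ?_))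
  · exact (corrHom_spec hc' U _).unique (corrHom_spec hc U a).symm
  · exact (corrHom_spec hc U _).unique (corrHom_spec hc' U a).symm
  · exact (corrHom_spec hc U _).unique (locCorr_i U a)
  · exact (corrHom_spec hc U a).p_eq.symm

end Compare

/-- The connecting maps of a chosen representative, at the two closed points, embed the classes in a
finite product of finite function sets. -/
theorem finite_ext (F G : NormalCoh.{0, u} P1) : Finite (Ext F G) := by
  have h1 := fun x : {x : Point // x ≠ Point.eta} => finite_killed F x.2
  have h2 := fun x : {x : Point // x ≠ Point.eta} => (finite_indivisible G x.2).to_subtype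
  refine Finite.of_injective
    (fun (q : Ext F G) (x : {x : Point // x ≠ Point.eta}) f =>
      (⟨connecting (Quotient.out q) x.1 f, connecting_indivisible _ x.2 f⟩ :
        {g : G.sheaf.sec (nhd x.1) | ∀ g', g = unif x.1 • g' → g = 0})) fun q q' h => ?_
  refine Quotient.out_equiv_out.1 (equivalent_of_connecting_eq fun x hx => funext fun f => ?_)
  exact congrArg Subtype.val (congrFun (congrFun h ⟨x, hx⟩) f)

end P1

end FOne

theorem mainTheorem7 (F G : FOne.NormalCoh.{0, u} FOne.P1) :
    Finite (F ⟶ G) ∧ Finite (FOne.Ext F G) :=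
  ⟨FOne.P1.finite_hom F G, FOne.P1.finite_ext F G⟩
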